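/- Let $V$ be a finite set with $n$ elements. A *distance matrix* on $V$ is a symmetric function $D:V\times V\to\mathbb{R}_{\ge 0}$ with $D(u,u)=0$ for all $u$. A *tree metric* on $V$ is a matrix of the form $T(u,v)=d(x_u,x_v)$, where $d$ is the path-length metric of a finite tree with non-negative edge lengths and $u\mapsto x_u$ is a (not necessarily injective or surjective) map from $V$ to its nodes; it is an *ultrametric* if the tree and a root can be chosen so that all $x_u$ have the same distance from the root. Write $\|A-B\|_0$ for the number of unordered pairs $\{u,v\}$, $u\neq v$, with $A(u,v)\neq B(u,v)$. In $L_0$ Fitting Tree Metrics (respectively $L_0$ Fitting Ultrametrics) the input is a distance matrix $D$ and the goal is to output a tree metric (respectively ultrametric) $T$ minimizing $\|T-D\|_0$. A factor-$\rho$ approximation always outputs a feasible $T$ with $\|T-D\|_0\le\rho\,\|S-D\|_0$ for every feasible $S$. Algorithms are real RAM programs (exact real arithmetic and comparisons at unit cost, integer addition and subtraction for addressing), and running times are measured in the number $n$ of elements. **Theorem.** A factor $\rho\ge 1$ approximation for $L_0$ Fitting Ultrametrics implies, in a black-box fashion, a factor $6\rho$ approximation for $L_0$ Fitting Tree Metrics.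 Precisely: there are a single oracle program $P$ and a polynomial $q$ such that for every real $\rho\ge 1$ and every $t:\mathbb{N}\to\mathbb{N}$ the following hold. 1. If a black box $O$ (any function from matrices to matrices of the same size) is a factor-$\rho$ approximation for $L_0$ Fitting Ultrametrics that takes time at most $t(n)$ on every distance matrix on $n$ elements, then $P$ with oracle $O$ is a factor-$6\rho$ approximation for $L_0$ Fitting Tree Metrics with total running time at most $n\,t(n)+q(n)$, the time taken by $O$ included. 2. If a program $A$ without oracle is a factor-$\rho$ approximation algorithm for $L_0$ Fitting Ultrametrics with running time at most $t(n)$, then the program obtained from $P$ by using $A$ in place of the oracle is a factor-$6\rho$ approximation algorithm for $L_0$ Fitting Tree Metrics with running time at most $n\,t(n)+q(n)$. In particular, a polynomial-time factor-$\rho$ approximation for ultrametrics yields a polynomial-time factor-$6\rho$ approximation for tree metrics. -/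

import Mathlib

open scoped NNReal

namespace L0Fit

/-! ### Distance matrices, tree metrics, ultrametrics, and the `L₀` objective -/

/-- Square matrices indexed by the ground set `V = {0, …, n - 1}`. -/
abbrev Mat (n : ℕ) : Type := Fin n → Fin n → ℝ

/-- A function from the unordered pairs to the non-negative reals, extended by `D u u = 0`. -/
structure IsDistanceMatrix {n : ℕ} (D : Mat n) : Prop where
  diag : ∀ u, D u u = 0
  symm : ∀ u v, D u v = D v u
  nonneg : ∀ u v, 0 ≤ D u v

/-- A finite tree with non-negative edge lengths (only the values of `length` on edges matter). -/
structure WeightedTree where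
  Node : Type
  finite : Finite Node
  graph : SimpleGraph Node
  isTree : graph.IsTree
  length : Sym2 Node → ℝ≥0

/-- The total length of the unique path between two nodes. -/
noncomputable def WeightedTree.dist (T : WeightedTree) (x y : T.Node) : ℝ :=
  (((T.isTree.existsUnique_path x y).choose.edges.map T.length).sum : ℝ≥0)

/-- `M` is the path metric of a weighted tree, restricted to the nodes that the elements of `V`
are mapped to.  Auxiliary nodes, and several elements at one node, are allowed. -/
def IsTreeMetric {n : ℕ} (M : Mat n) : Prop :=
  ∃ (T : WeightedTree) (node : Fin n → T.Node), ∀ u v, M u v = T.dist (node u) (node v)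

/-- `M` is the path metric of a rooted weighted tree in which all elements of `V` lie at the same
depth (whatever hangs below or beside them is irrelevant for `M`, so these nodes may be thought of
as the leaves). -/
def IsUltrametric {n : ℕ} (M : Mat n) : Prop :=
  ∃ (T : WeightedTree) (node : Fin n → T.Node) (root : T.Node) (depth : ℝ),
    (∀ u, T.dist root (node u) = depth) ∧ ∀ u v, M u v = T.dist (node u) (node v)

open Classical in
/-- `‖A - B‖₀`: the number of unordered pairs on which two symmetric matrices disagree. -/
noncomputable def disagreements {n : ℕ} (A B : Mat n) : ℕ :=
  (Finset.univ.filter fun p : Fin n × Fin n => p.1 < p.2 ∧ A p.1 p.2 ≠ B p.1 p.2).card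

/-- `R` is a feasible output for the input `D` whose cost is at most `ρ` times the cost of every
feasible output (hence at most `ρ` times the optimum). -/
def IsApproxSolution (Feasible : ∀ {n : ℕ}, Mat n → Prop) (ρ : ℝ) {n : ℕ} (D R : Mat n) : Prop :=
  Feasible R ∧ ∀ S : Mat n, Feasible S → (disagreements R D : ℝ) ≤ ρ * disagreements S D

/-! ### Real RAM programs with oracle calls

The memory consists of integer arrays (indexed by one natural number) and real arrays (indexed by
two natural numbers), addressed indirectly.  Integers admit addition and truncated subtraction,
reals admit the four field operations (`x / 0 = 0`) and exact comparison. -/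

/-- Integer expressions; `cell a i` is entry `i` of integer array number `a`. -/
inductive NExp where
  | const (k : ℕ)
  | cell (a : ℕ) (i : NExp)
  | add (e f : NExp)
  | sub (e f : NExp)

/-- Real expressions; `cell a i j` is entry `(i, j)` of real array number `a`. -/
inductive RExp where
  | ofNat (e : NExp)
  | cell (a : ℕ) (i j : NExp)
  | add (e f : RExp)
  | sub (e f : RExp)
  | mul (e f : RExp)
  | div (e f : RExp)

/-- Tests. -/
inductive BExp where
  | leN (e f : NExp)
  | leR (e f : RExp)
  | not (b : BExp)
  | and (b c : BExp)

/-- Programs.  `oracle k src dst` asks the oracle about the matrix formed by the entries `(i, j)`,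
`i, j < k`, of real array `src`, and writes the answer to real array `dst`; `call Q k src dst` does
the same with the program `Q`, run in a fresh memory, in the role of the oracle. -/
inductive Prog where
  | nop
  | setN (a : ℕ) (i e : NExp)
  | setR (a : ℕ) (i j : NExp) (e : RExp)
  | seq (p q : Prog)
  | ite (b : BExp) (p q : Prog)
  | loop (b : BExp) (p : Prog)
  | oracle (k : NExp) (src dst : ℕ)
  | call (Q : Prog) (k : NExp) (src dst : ℕ)

/-- The memory. -/
structure Store where
  int : ℕ → ℕ → ℕ
  real : ℕ → ℕ → ℕ → ℝ

namespace Store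

/-- The initial memory on input `D`: the size `n` in entry `0` of integer array `0`, the matrix `D`
in real array `0`, and zeros everywhere else. -/
noncomputable def init {n : ℕ} (D : Mat n) : Store where
  int a i := if a = 0 ∧ i = 0 then n else 0
  real a i j := if h : a = 0 ∧ i < n ∧ j < n then D ⟨i, h.2.1⟩ ⟨j, h.2.2⟩ else 0

/-- The `n × n` matrix stored in real array `a`. -/
def read (s : Store) (a n : ℕ) : Mat n := fun i j => s.real a i j

/-- Overwrite the upper left `n × n` part of real array `a` by `M`. -/
noncomputable def write (s : Store) (a : ℕ) {n : ℕ} (M : Mat n) : Store where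
  int := s.int
  real b i j :=
    if h : b = a ∧ i < n ∧ j < n then M ⟨i, h.2.1⟩ ⟨j, h.2.2⟩ else s.real b i j

/-- Overwrite one integer cell. -/
def setInt (s : Store) (a i x : ℕ) : Store where
  int b k := if b = a ∧ k = i then x else s.int b k
  real := s.real

/-- Overwrite one real cell. -/
noncomputable def setReal (s : Store) (a i j : ℕ) (x : ℝ) : Store where
  int := s.int
  real b k l := if b = a ∧ k = i ∧ l = j then x else s.real b k l

end Store

/-- Value of an integer expression. -/
def NExp.eval (s : Store) : NExp → ℕ
  | .const k => k
  | .cell a i => s.int a (i.eval s)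
  | .add e f => e.eval s + f.eval s
  | .sub e f => e.eval s - f.eval s

/-- Value of a real expression. -/
noncomputable def RExp.eval (s : Store) : RExp → ℝ
  | .ofNat e => (e.eval s : ℝ)
  | .cell a i j => s.real a (i.eval s) (j.eval s)
  | .add e f => e.eval s + f.eval s
  | .sub e f => e.eval s - f.eval s
  | .mul e f => e.eval s * f.eval s
  | .div e f => e.eval s / f.eval s

/-- Truth of a test. -/
def BExp.holds (s : Store) : BExp → Prop
  | .leN e f => e.eval s ≤ f.eval s
  | .leR e f => e.eval s ≤ f.eval s
  | .not b => ¬ b.holds s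
  | .and b c => b.holds s ∧ c.holds s

/-- Number of operations performed by evaluating an integer expression. -/
def NExp.size : NExp → ℕ
  | .const _ => 1
  | .cell _ i => i.size + 1
  | .add e f => e.size + f.size + 1
  | .sub e f => e.size + f.size + 1

/-- Number of operations performed by evaluating a real expression. -/
def RExp.size : RExp → ℕ
  | .ofNat e => e.size + 1
  | .cell _ i j => i.size + j.size + 1
  | .add e f => e.size + f.size + 1
  | .sub e f => e.size + f.size + 1
  | .mul e f => e.size + f.size + 1
  | .div e f => e.size + f.size + 1

/-- Number of operations performed by evaluating a test. -/
def BExp.size : BExp → ℕ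
  | .leN e f => e.size + f.size + 1
  | .leR e f => e.size + f.size + 1
  | .not b => b.size + 1
  | .and b c => b.size + c.size + 1

/-- A black box that turns matrices into matrices of the same size: on a query it gives an answer
together with the time it took, or (`none`) never answers. -/
abbrev Oracle : Type := ∀ n : ℕ, Mat n → Option (Mat n × ℕ)

/-- The oracle that never answers.  A program that halts with it makes no oracle call. -/
def noOracle : Oracle := fun _ _ => none

/-- `Exec O p s s' c`: with oracle `O`, program `p` started in memory `s` halts in memory `s'` after
`c` steps.  Copying a query and its answer is charged one step per entry, and the time taken by the
oracle or by the called program is counted. -/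
inductive Exec (O : Oracle) : Prog → Store → Store → ℕ → Prop where
  | nop (s : Store) : Exec O .nop s s 1
  | setN (s : Store) (a : ℕ) (i e : NExp) :
      Exec O (.setN a i e) s (s.setInt a (i.eval s) (e.eval s)) (i.size + e.size + 1)
  | setR (s : Store) (a : ℕ) (i j : NExp) (e : RExp) :
      Exec O (.setR a i j e) s (s.setReal a (i.eval s) (j.eval s) (e.eval s))
        (i.size + j.size + e.size + 1)
  | seq {p q : Prog} {s s' s'' : Store} {c d : ℕ} :
      Exec O p s s' c → Exec O q s' s'' d → Exec O (.seq p q) s s'' (c + d)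
  | ite_true {b : BExp} {p q : Prog} {s s' : Store} {c : ℕ} :
      b.holds s → Exec O p s s' c → Exec O (.ite b p q) s s' (b.size + c)
  | ite_false {b : BExp} {p q : Prog} {s s' : Store} {c : ℕ} :
      ¬ b.holds s → Exec O q s s' c → Exec O (.ite b p q) s s' (b.size + c)
  | loop_true {b : BExp} {p : Prog} {s s' s'' : Store} {c d : ℕ} :
      b.holds s → Exec O p s s' c → Exec O (.loop b p) s' s'' d →
      Exec O (.loop b p) s s'' (b.size + c + d)
  | loop_false {b : BExp} {p : Prog} {s : Store} :
      ¬ b.holds s → Exec O (.loop b p) s s b.size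
  | oracle {k : NExp} {src dst : ℕ} {s : Store} {R : Mat (k.eval s)} {c : ℕ} :
      O (k.eval s) (s.read src (k.eval s)) = some (R, c) →
      Exec O (.oracle k src dst) s (s.write dst R) (k.size + 2 * k.eval s ^ 2 + c + 1)
  | call {Q : Prog} {k : NExp} {src dst : ℕ} {s s' : Store} {c : ℕ} :
      Exec O Q (Store.init (s.read src (k.eval s))) s' c →
      Exec O (.call Q k src dst) s (s.write dst (s'.read 1 (k.eval s)))
        (k.size + 2 * k.eval s ^ 2 + c + 1)

/-- `P.subst A` is the program `P` with the oracle replaced by the program `A`. -/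
def Prog.subst (P A : Prog) : Prog :=
  match P with
  | .nop => .nop
  | .setN a i e => .setN a i e
  | .setR a i j e => .setR a i j e
  | .seq p q => .seq (p.subst A) (q.subst A)
  | .ite b p q => .ite b (p.subst A) (q.subst A)
  | .loop b p => .loop b (p.subst A)
  | .oracle k src dst => .call A k src dst
  | .call Q k src dst => .call (Q.subst A) k src dst

/-- With oracle `O`, program `p` halts on input `D` after `c` steps with `R` in the output array,
which is real array `1`. -/
def Prog.Computes (O : Oracle) (p : Prog) {n : ℕ} (D R : Mat n) (c : ℕ) : Prop :=
  ∃ s : Store, Exec O p (Store.init D) s c ∧ s.read 1 n = R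

/-- With oracle `O`, program `p` is a factor `ρ` approximation algorithm for `L₀` fitting of
distance matrices on `n` elements by `Feasible` matrices, with running time at most `t n`. -/
def IsApproxAlgorithm (Feasible : ∀ {n : ℕ}, Mat n → Prop) (O : Oracle) (p : Prog) (ρ : ℝ)
    (t : ℕ → ℕ) : Prop :=
  ∀ (n : ℕ) (D : Mat n), IsDistanceMatrix D →
    ∃ (R : Mat n) (c : ℕ), p.Computes O D R c ∧ IsApproxSolution Feasible ρ D R ∧ c ≤ t n

/-- The same for a black box. -/
def IsApproxOracle (Feasible : ∀ {n : ℕ}, Mat n → Prop) (O : Oracle) (ρ : ℝ)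
    (t : ℕ → ℕ) : Prop :=
  ∀ (n : ℕ) (D : Mat n), IsDistanceMatrix D →
    ∃ (R : Mat n) (c : ℕ), O n D = some (R, c) ∧ IsApproxSolution Feasible ρ D R ∧ c ≤ t n

end L0Fit

namespace L0Fit

/-! ### Distances in weighted trees -/

namespace WeightedTree

variable (T : WeightedTree)

/-! The reduction is the Farris transform, tried with every element as pivot. For a pivot `a`, let
`c u = r - D a u`, where `r` bounds all `D a u`; `slack` is `c u + c v`. If a tree metric `T` has
the same distances from `a` as `D`, its four-point condition at `a` becomes the three-point
condition for `T u v + c u + c v`. Conversely, subtracting `c u + c v` from an ultrametric shortens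
pendant edges, and `clamp` guarantees that they are long enough (`pivotTree_isTreeMetric`).

Compare with any tree metric `T` of cost `k`. A pair is bad for `a` if `T` and `D` differ on it or
on the distance of one of its elements from `a`. On all other pairs the transform loses nothing.
Hence some ultrametric differs from the query on bad pairs only (`exists_isUltrametric_near`), and
transforming the answer back adds at most the bad pairs once more (`disagreements_pivotTree_le`).
Double counting gives at most `3 * n * k` bad pairs over all pivots (`sum_card_badPairs_le`), so
some pivot has at most `3 * k` and yields cost at most `ρ * 3 * k + 3 * k ≤ 6 * ρ * k`. The good
pivot depends on the unknown `T`, but the cheapest result over all pivots is at least as good.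

Medians in trees supply the four-point condition, and `exists_tree_of_strong_triangle` builds a tree
from nested clusters. The program is verified by loop invariants that carry cost bounds;
`Exec.subst` then exchanges the oracle for a program at equal cost. -/

theorem dist_eq_of_isPath {x y : T.Node} (p : T.graph.Walk x y) (hp : p.IsPath) :
    T.dist x y = ((p.edges.map T.length).sum : ℝ≥0) := by
  have h := (T.isTree.existsUnique_path x y).choose_spec.2 p hp
  unfold WeightedTree.dist
  rw [← h]

theorem exists_isPath (x y : T.Node) : ∃ p : T.graph.Walk x y, p.IsPath :=
  (T.isTree.existsUnique_path x y).exists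

theorem dist_nonneg (x y : T.Node) : 0 ≤ T.dist x y := NNReal.coe_nonneg _

theorem dist_self (x : T.Node) : T.dist x x = 0 := by
  rw [T.dist_eq_of_isPath .nil .nil]
  simp

theorem dist_comm (x y : T.Node) : T.dist x y = T.dist y x := by
  obtain ⟨p, hp⟩ := T.exists_isPath x y
  rw [T.dist_eq_of_isPath p hp, T.dist_eq_of_isPath p.reverse hp.reverse]
  simp [List.sum_reverse]

/-- The node `z` lies on the path from `x` to `y`. -/
def Between (x z y : T.Node) : Prop :=
  ∃ (p : T.graph.Walk x z) (q : T.graph.Walk z y), (p.append q).IsPath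

variable {T}

theorem between_of_mem {x y z : T.Node} {p : T.graph.Walk x y} (hp : p.IsPath)
    (hz : z ∈ p.support) : T.Between x z y := by
  obtain ⟨q, r, rfl⟩ := p.mem_support_iff_exists_append.mp hz
  exact ⟨q, r, hp⟩

theorem Between.mem {x y z : T.Node} (h : T.Between x z y) {p : T.graph.Walk x y}
    (hp : p.IsPath) : z ∈ p.support := by
  obtain ⟨q, r, hqr⟩ := h
  rw [(T.isTree.existsUnique_path x y).unique hp hqr]
  simp

theorem Between.dist_eq {x y z : T.Node} (h : T.Between x z y) :
    T.dist x y = T.dist x z + T.dist z y := by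
  obtain ⟨q, r, hqr⟩ := h
  rw [T.dist_eq_of_isPath _ hqr, T.dist_eq_of_isPath q hqr.of_append_left,
    T.dist_eq_of_isPath r hqr.of_append_right]
  simp

theorem Between.trans_right {x y z w : T.Node} (h : T.Between x z y) (h' : T.Between z w y) :
    T.Between x w y := by
  obtain ⟨q, r, hqr⟩ := h
  refine between_of_mem hqr ?_
  simp [h'.mem hqr.of_append_right]

/-- Two nodes on one path are comparable. -/
theorem Between.total {x y z w : T.Node} (h : T.Between x z y) (h' : T.Between x w y) :
    T.Between z w y ∨ T.Between w z y := by
  obtain ⟨q, r, hqr⟩ := h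
  have hw := h'.mem hqr
  rw [SimpleGraph.Walk.mem_support_append_iff] at hw
  rcases hw with hw | hw
  · right
    obtain ⟨q₁, q₂, rfl⟩ := q.mem_support_iff_exists_append.mp hw
    refine ⟨q₂, r, ?_⟩
    rw [← SimpleGraph.Walk.append_assoc] at hqr
    exact hqr.of_append_right
  · exact .inl (between_of_mem hqr.of_append_right hw)

/-- Any three nodes have a median. -/
theorem exists_median (x y a : T.Node) :
    ∃ z, T.Between x z y ∧ T.Between x z a ∧ T.Between y z a := by
  classical
  obtain ⟨p, hp⟩ := T.exists_isPath x a
  obtain ⟨q, hq⟩ := T.exists_isPath y a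
  -- `z` is the first node of `p` that lies on `q`. The part of `p` up to `z` therefore meets `q`
  -- only in `z`, so it can be continued along `q` backwards to `y`.
  obtain ⟨z, hzq, hzp, hz⟩ := p.exists_mem_support_forall_mem_support_imp_eq q.support.toFinset
    ⟨a, by simp⟩
  rw [List.mem_toFinset] at hzq
  refine ⟨z, ⟨p.takeUntil z hzp, (q.takeUntil z hzq).reverse, ?_⟩, between_of_mem hp hzp,
    between_of_mem hq hzq⟩
  have hp' := hp.takeUntil hzp
  have hq' := (hq.takeUntil hzq).reverse
  rw [SimpleGraph.Walk.isPath_def, SimpleGraph.Walk.support_append, List.nodup_append']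
  refine ⟨hp'.support_nodup, hq'.support_nodup.tail, ?_⟩
  intro t ht ht'
  have h1 : t = z := by
    refine hz t ?_ ht
    rw [List.mem_toFinset]
    have := List.mem_of_mem_tail ht'
    rw [SimpleGraph.Walk.support_reverse, List.mem_reverse] at this
    exact q.support_takeUntil_subset_support hzq this
  subst h1
  have := hq'.support_nodup
  rw [← SimpleGraph.Walk.cons_tail_support] at this
  exact (List.nodup_cons.mp this).1 ht'

theorem dist_triangle (x z y : T.Node) : T.dist x y ≤ T.dist x z + T.dist z y := by
  obtain ⟨w, h₁, h₂, h₃⟩ := exists_median x y z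
  have := T.dist_nonneg w z
  rw [h₁.dist_eq, h₂.dist_eq, T.dist_comm z y, h₃.dist_eq, T.dist_comm w y]
  linarith

/-- The four-point condition. -/
theorem dist_four_point (a x y z : T.Node) :
    T.dist x z + T.dist a y ≤ max (T.dist x y + T.dist a z) (T.dist y z + T.dist a x) := by
  obtain ⟨c, h₁, h₂, h₃⟩ := exists_median x y a
  obtain ⟨d, k₁, k₂, k₃⟩ := exists_median y z a
  have e₁ := h₁.dist_eq
  have e₂ := h₂.dist_eq
  have e₃ := h₃.dist_eq
  have f₁ := k₁.dist_eq
  have f₂ := k₂.dist_eq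
  have f₃ := k₃.dist_eq
  simp only [T.dist_comm a]
  rw [T.dist_comm y d] at *
  rw [T.dist_comm y c] at *
  -- Both medians lie on the path from `y` to `a`. The one nearer to `a` also lies on the path from
  -- `a` to the third element, and going from `x` to `z` through it gives the bound.
  rcases h₃.total k₂ with h | h
  · have h4 := (h₂.trans_right h).dist_eq
    have := dist_triangle x d z
    rw [T.dist_comm z d] at *
    refine le_max_of_le_right ?_
    linarith
  · have h4 := (k₃.trans_right h).dist_eq
    have := dist_triangle x c z
    rw [T.dist_comm z c] at *
    refine le_max_of_le_left ?_
    linarith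

end WeightedTree

/-! ### Metric conditions satisfied by tree metrics and ultrametrics -/

theorem IsTreeMetric.diag {n : ℕ} {M : Mat n} (h : IsTreeMetric M) (u : Fin n) : M u u = 0 := by
  obtain ⟨T, f, h⟩ := h
  rw [h, T.dist_self]

theorem IsTreeMetric.symm {n : ℕ} {M : Mat n} (h : IsTreeMetric M) (u v : Fin n) :
    M u v = M v u := by
  obtain ⟨T, f, h⟩ := h
  rw [h, h, T.dist_comm]

theorem IsTreeMetric.triangle {n : ℕ} {M : Mat n} (h : IsTreeMetric M) (u v w : Fin n) :
    M u w ≤ M u v + M v w := by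
  obtain ⟨T, f, h⟩ := h
  simp only [h]
  exact WeightedTree.dist_triangle _ _ _

theorem IsTreeMetric.four_point {n : ℕ} {M : Mat n} (h : IsTreeMetric M) (a u v w : Fin n) :
    M u w + M a v ≤ max (M u v + M a w) (M v w + M a u) := by
  obtain ⟨T, f, h⟩ := h
  simp only [h]
  exact WeightedTree.dist_four_point _ _ _ _

theorem IsUltrametric.isTreeMetric {n : ℕ} {M : Mat n} (h : IsUltrametric M) :
    IsTreeMetric M := by
  obtain ⟨T, f, _, _, _, h⟩ := h
  exact ⟨T, f, h⟩

/-- This is the four-point condition with the root as fourth point: all distances from the root are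
equal and cancel. -/
theorem IsUltrametric.strong_triangle {n : ℕ} {M : Mat n} (h : IsUltrametric M)
    (u v w : Fin n) : M u w ≤ max (M u v) (M v w) := by
  obtain ⟨T, f, r, d, hd, h⟩ := h
  have := WeightedTree.dist_four_point r (f u) (f v) (f w)
  simp only [hd, ← h] at this
  rw [max_add_add_right] at this
  linarith

/-! ### Trees given by parent pointers -/

/-- The graph in which every vertex other than `r` is joined to its parent. -/
def parentGraph {V : Type} (r : V) (p : V → V) : SimpleGraph V :=
  SimpleGraph.fromRel fun x y => x ≠ r ∧ p x = y

section ParentTree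

variable {V : Type} {r : V} {p : V → V} {rank : V → ℕ}

theorem parentGraph_adj_parent (hrank : ∀ x, x ≠ r → rank (p x) < rank x) {x : V} (hx : x ≠ r) :
    (parentGraph r p).Adj x (p x) := by
  refine ⟨fun h => ?_, .inl ⟨hx, rfl⟩⟩
  have := hrank x hx
  rw [← h] at this
  exact lt_irrefl _ this

/-- The path to the root follows the parent pointers. -/
theorem parentGraph_exists_path (hrank : ∀ x, x ≠ r → rank (p x) < rank x)
    (len : Sym2 V → ℝ≥0) (h : V → ℝ) (hlen : ∀ x, x ≠ r → (len s(x, p x) : ℝ) = h (p x) - h x)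
    (x : V) : ∃ w : (parentGraph r p).Walk x r, w.IsPath ∧ (∀ z ∈ w.support, rank z ≤ rank x) ∧
      (∀ S : Set V, x ∈ S → (∀ y ∈ S, y ≠ r → p y ∈ S) → ∀ z ∈ w.support, z ∈ S) ∧
      (x ≠ r → p x ∈ w.support) ∧
      (((w.edges.map len).sum : ℝ≥0) : ℝ) = h r - h x := by
  induction hk : rank x using Nat.strong_induction_on generalizing x with
  | _ k ih =>
    subst hk
    by_cases hx : x = r
    · subst hx
      exact ⟨.nil, .nil, by simp, fun S hS _ z hz => by simp_all, by simp, by simp⟩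
    · obtain ⟨w, hw, hr, hS, -, hl⟩ := ih _ (hrank x hx) (p x) rfl
      refine ⟨.cons (parentGraph_adj_parent hrank hx) w, ?_, ?_, ?_, ?_, ?_⟩
      · rw [SimpleGraph.Walk.cons_isPath_iff]
        refine ⟨hw, fun hmem => ?_⟩
        exact absurd (hr x hmem) (not_le.mpr (hrank x hx))
      · intro z hz
        rw [SimpleGraph.Walk.support_cons, List.mem_cons] at hz
        rcases hz with rfl | hz
        · exact le_rfl
        · exact (hr z hz).trans (hrank x hx).le
      -- A set closed under parents contains the whole path to the root. Such sets later are the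
      -- branches of single elements.
      · intro S hxS hcl z hz
        rw [SimpleGraph.Walk.support_cons, List.mem_cons] at hz
        rcases hz with rfl | hz
        · exact hxS
        · exact hS S (hcl x hxS hx) hcl z hz
      · intro _
        simp
      · rw [SimpleGraph.Walk.edges_cons, List.map_cons, List.sum_cons, NNReal.coe_add, hl,
          hlen x hx]
        ring

/-- The pointers lead to `r`, so the graph is connected. Every edge joins a non-root vertex to its
parent, so there are fewer edges than vertices, which for a connected graph means a tree. -/
theorem parentGraph_isTree [Finite V] (hrank : ∀ x, x ≠ r → rank (p x) < rank x) :
    (parentGraph r p).IsTree := by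
  have hconn : (parentGraph r p).Connected := by
    rw [SimpleGraph.connected_iff_exists_forall_reachable]
    refine ⟨r, fun x => ?_⟩
    induction hk : rank x using Nat.strong_induction_on generalizing x with
    | _ k ih =>
      subst hk
      by_cases hx : x = r
      · rw [hx]
      · exact (ih _ (hrank x hx) (p x) rfl).trans
          (parentGraph_adj_parent hrank hx).symm.reachable
  rw [SimpleGraph.isTree_iff_connected_and_card]
  refine ⟨hconn, le_antisymm ?_ hconn.card_vert_le_card_edgeSet_add_one⟩
  have := Fintype.ofFinite V
  classical
  let f : {x : V // x ≠ r} → (parentGraph r p).edgeSet := fun x =>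
    ⟨s(x.1, p x.1), parentGraph_adj_parent hrank x.2⟩
  have hf : Function.Surjective f := by
    rintro ⟨e, he⟩
    induction e with
    | _ x y =>
      have he' : (parentGraph r p).Adj x y := he
      rw [parentGraph, SimpleGraph.fromRel_adj] at he'
      obtain ⟨hx, hxy⟩ | ⟨hy, hxy⟩ := he'.2
      · exact ⟨⟨x, hx⟩, Subtype.ext (by simp [f, hxy])⟩
      · exact ⟨⟨y, hy⟩, Subtype.ext (by simp [f, hxy, Sym2.eq_swap])⟩
  have h1 := Nat.card_le_card_of_surjective f hf
  have h2 : Nat.card {x : V // x ≠ r} + 1 = Nat.card V := by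
    rw [Nat.card_eq_fintype_card, Nat.card_eq_fintype_card, Fintype.card_subtype_compl,
      Fintype.card_subtype_eq]
    have : 0 < Fintype.card V := Fintype.card_pos_iff.mpr ⟨r⟩
    omega
  omega

/-- The weighted tree with parent map `p` in which the node `x` is drawn at height `h x`. -/
noncomputable abbrev parentTree [Finite V] (hrank : ∀ x, x ≠ r → rank (p x) < rank x) (h : V → ℝ) :
    WeightedTree where
  Node := V
  finite := inferInstance
  graph := parentGraph r p
  isTree := parentGraph_isTree hrank
  length := Sym2.lift ⟨fun x y => Real.nnabs (h x - h y), fun x y => by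
    ext
    simp [abs_sub_comm]⟩

theorem parentTree_length [Finite V] (hrank : ∀ x, x ≠ r → rank (p x) < rank x) {h : V → ℝ}
    (hh : ∀ x, x ≠ r → h x ≤ h (p x)) (x : V) (hx : x ≠ r) :
    ((parentTree hrank h).length s(x, p x) : ℝ) = h (p x) - h x := by
  have := hh x hx
  simp only [parentTree, Sym2.lift_mk, Real.coe_nnabs]
  rw [abs_sub_comm, abs_of_nonneg (by linarith)]

variable [Finite V] (hrank : ∀ x, x ≠ r → rank (p x) < rank x) {h : V → ℝ}

theorem parentTree_dist_root (hh : ∀ x, x ≠ r → h x ≤ h (p x))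
    (x : V) : (parentTree hrank h).dist x r = h r - h x := by
  obtain ⟨w, hw, -, -, -, hl⟩ := parentGraph_exists_path hrank (parentTree hrank h).length h
    (parentTree_length hrank hh) x
  rw [WeightedTree.dist_eq_of_isPath (parentTree hrank h) w hw]
  exact hl

theorem parentTree_between_parent (hh : ∀ x, x ≠ r → h x ≤ h (p x))
    {x y : V} (hxy : (parentTree hrank h).Between x y r)
    (hy : y ≠ r) : (parentTree hrank h).Between x (p y) r := by
  obtain ⟨w, hw, -, -, hp, -⟩ := parentGraph_exists_path hrank (parentTree hrank h).length h
    (parentTree_length hrank hh) y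
  exact hxy.trans_right (WeightedTree.between_of_mem (T := parentTree hrank h) hw (hp hy))

theorem parentTree_mem_of_between (hh : ∀ x, x ≠ r → h x ≤ h (p x))
    {x z : V} (hxz : (parentTree hrank h).Between x z r)
    {S : Set V} (hx : x ∈ S) (hS : ∀ y ∈ S, y ≠ r → p y ∈ S) : z ∈ S := by
  obtain ⟨w, hw, -, hw', -, -⟩ := parentGraph_exists_path hrank (parentTree hrank h).length h
    (parentTree_length hrank hh) x
  exact hw' S hx hS z (hxz.mem (T := parentTree hrank h) hw)

/-- The distance is realized by some common ancestor. -/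
theorem parentTree_dist_eq (hh : ∀ x, x ≠ r → h x ≤ h (p x))
    (x y : V) : ∃ z : V, (parentTree hrank h).Between x z r ∧
    (parentTree hrank h).Between y z r ∧ (parentTree hrank h).dist x y = 2 * h z - h x - h y := by
  obtain ⟨z, h₁, h₂, h₃⟩ := WeightedTree.exists_median (T := parentTree hrank h) x y r
  refine ⟨z, h₂, h₃, ?_⟩
  have e₁ := h₁.dist_eq
  have e₂ := h₂.dist_eq
  have e₃ := h₃.dist_eq
  have e₄ := WeightedTree.dist_comm (parentTree hrank h) z y
  have f₁ := parentTree_dist_root hrank hh x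
  have f₂ := parentTree_dist_root hrank hh y
  have f₃ := parentTree_dist_root hrank hh z
  linarith

/-- Every common ancestor gives an upper bound for the distance. -/
theorem parentTree_dist_le (hh : ∀ x, x ≠ r → h x ≤ h (p x))
    {x y z : V} (hx : (parentTree hrank h).Between x z r)
    (hy : (parentTree hrank h).Between y z r) :
    (parentTree hrank h).dist x y ≤ 2 * h z - h x - h y := by
  have e₁ := WeightedTree.dist_triangle (T := parentTree hrank h) x z y
  have e₂ := hx.dist_eq
  have e₃ := hy.dist_eq
  have e₄ := WeightedTree.dist_comm (parentTree hrank h) z y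
  have f₁ := parentTree_dist_root hrank hh x
  have f₂ := parentTree_dist_root hrank hh y
  have f₃ := parentTree_dist_root hrank hh z
  linarith

end ParentTree

/-! ### Realizing three-point matrices by trees -/

/-- A finite set of reals is covered by an initial segment of a monotone sequence. -/
theorem exists_monotone_enum (H : Finset ℝ) :
    ∃ (N : ℕ) (η : ℕ → ℝ), Monotone η ∧ ∀ a ∈ H, ∃ i < N, η i = a := by
  rcases H.eq_empty_or_nonempty with rfl | hne
  · exact ⟨0, fun _ => 0, monotone_const, by simp⟩
  have hpos : 0 < H.card := hne.card_pos
  -- The increasing enumeration of `H`, frozen at its maximum: `η N` still makes sense and bounds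
  -- all of `H`, as the height of the root must.
  refine ⟨H.card, fun i => H.orderEmbOfFin rfl ⟨min i (H.card - 1), by omega⟩, ?_, ?_⟩
  · intro i j hij
    refine (H.orderEmbOfFin rfl).monotone ?_
    rw [Fin.mk_le_mk]
    omega
  · intro a ha
    have : a ∈ Set.range (H.orderEmbOfFin rfl) := by
      rw [Finset.range_orderEmbOfFin]
      exact ha
    obtain ⟨i, rfl⟩ := this
    refine ⟨i, i.2, ?_⟩
    have := i.2
    exact congrArg _ (Fin.ext (min_eq_left (by omega)))

section LevelTree

variable {n : ℕ} {U : Mat n} (hsymm : ∀ u v, U u v = U v u)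
  (htri : ∀ u v w, U u w ≤ max (U u v) (U v w))

/-- Two elements are in the same cluster at height `a`. -/
def clusterSetoid (a : ℝ) : Setoid (Fin n) where
  -- Elements at height `0` that meet at height `a` have distance `2 * a`. The case `u = v` is
  -- separate because nothing is assumed about the diagonal of `U`.
  r u v := u = v ∨ U u v ≤ 2 * a
  iseqv :=
    { refl := fun _ => .inl rfl
      symm := by
        rintro u v (rfl | h)
        · exact .inl rfl
        · exact .inr (hsymm u v ▸ h)
      trans := by
        rintro u v w (rfl | h) (rfl | h')
        · exact .inl rfl
        · exact .inr h'
        · exact .inr h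
        · exact .inr ((htri u v w).trans (max_le h h')) }

/-- The representative of the cluster of `u` at height `a`. -/
noncomputable def clusterRep (a : ℝ) (u : Fin n) : Fin n :=
  (Quotient.mk (clusterSetoid hsymm htri a) u).out

theorem clusterRep_eq_iff (a : ℝ) (u v : Fin n) :
    clusterRep hsymm htri a u = clusterRep hsymm htri a v ↔ u = v ∨ U u v ≤ 2 * a := by
  unfold clusterRep
  rw [Quotient.out_inj, Quotient.eq]
  rfl

/-- Clusters only grow with the height, so a representative chosen lower down stays in the cluster
of `u`. This makes the parent of a cluster of `u` the next cluster of `u`. -/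
theorem clusterRep_clusterRep {a b : ℝ} (hab : a ≤ b) (u : Fin n) :
    clusterRep hsymm htri b (clusterRep hsymm htri a u) = clusterRep hsymm htri b u := by
  rw [clusterRep_eq_iff]
  have h : clusterRep hsymm htri a (clusterRep hsymm htri a u) = clusterRep hsymm htri a u := by
    conv_lhs => rw [clusterRep, clusterRep, Quotient.out_eq]
    rfl
  rw [clusterRep_eq_iff] at h
  exact h.imp id fun h => h.trans (by linarith)

/-- The cluster of `u` at level `i`, as a node of the level tree; `none` is the root. -/
noncomputable def levelNode (N : ℕ) (η : ℕ → ℝ) (u : Fin n) (i : ℕ) : Option (Fin n × Fin N) :=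
  if h : i < N then some (clusterRep hsymm htri (η i) u, ⟨i, h⟩) else none

/-- The parent map of the level tree. -/
noncomputable def levelParent (N : ℕ) (η : ℕ → ℝ) :
    Option (Fin n × Fin N) → Option (Fin n × Fin N)
  | none => none
  | some (u, i) => levelNode hsymm htri N η u (i + 1)

/-- The number of levels above a node. -/
def levelRank {n N : ℕ} : Option (Fin n × Fin N) → ℕ
  | none => 0
  | some (_, i) => N - i

/-- The height of a node of the level tree. -/
def levelHeight {n N : ℕ} (η : ℕ → ℝ) : Option (Fin n × Fin N) → ℝ
  | none => η N
  | some (_, i) => η i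

theorem levelRank_lt (N : ℕ) (η : ℕ → ℝ) (x : Option (Fin n × Fin N)) (hx : x ≠ none) :
    levelRank (levelParent hsymm htri N η x) < levelRank x := by
  match x with
  | none => exact absurd rfl hx
  | some (u, i) =>
    have := i.2
    simp only [levelParent, levelNode]
    split_ifs <;> simp only [levelRank] <;> omega

theorem levelHeight_le {N : ℕ} {η : ℕ → ℝ} (hη : Monotone η) (x : Option (Fin n × Fin N))
    (hx : x ≠ none) : levelHeight η x ≤ levelHeight η (levelParent hsymm htri N η x) := by
  match x with
  | none => exact absurd rfl hx
  | some (u, i) =>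
    have := i.2
    simp only [levelParent, levelNode]
    split_ifs <;> simp only [levelHeight] <;> apply hη <;> omega

theorem levelParent_levelNode {N : ℕ} {η : ℕ → ℝ} (hη : Monotone η) (u : Fin n) (i : ℕ) :
    levelParent hsymm htri N η (levelNode hsymm htri N η u i) =
      levelNode hsymm htri N η u (i + 1) := by
  by_cases h : i < N
  · rw [levelNode, dif_pos h, levelParent, levelNode, levelNode]
    simp only [clusterRep_clusterRep hsymm htri (hη i.le_succ)]
  · rw [levelNode, dif_neg h, levelNode, dif_neg (by omega), levelParent]

theorem levelTree_between {N : ℕ} {η : ℕ → ℝ} (hη : Monotone η) (u : Fin n) {i j : ℕ}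
    (hij : i ≤ j) :
    (parentTree (levelRank_lt hsymm htri N η) (levelHeight η)).Between
      (levelNode hsymm htri N η u i) (levelNode hsymm htri N η u j) none := by
  induction j, hij using Nat.le_induction with
  | base =>
    obtain ⟨w, hw⟩ := (parentTree (levelRank_lt hsymm htri N η) (levelHeight η)).exists_isPath
      (levelNode hsymm htri N η u i) none
    exact WeightedTree.between_of_mem hw w.start_mem_support
  | succ j _ ih =>
    by_cases hj : levelNode hsymm htri N η u j = none
    · have : levelNode hsymm htri N η u (j + 1) = none := by
        rw [← levelParent_levelNode hsymm htri hη, hj, levelParent]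
      rw [hj] at ih
      rw [this]
      exact ih
    · rw [← levelParent_levelNode hsymm htri hη]
      exact parentTree_between_parent _ (levelHeight_le hsymm htri hη) ih hj

/-- A matrix with the three-point condition is realized by a tree in which the element `u` is
drawn at height `c u`, provided that `c u` is below every branching above `u`. -/
theorem exists_tree_of_strong_triangle (hsymm : ∀ u v, U u v = U v u)
    (htri : ∀ u v w, U u w ≤ max (U u v) (U v w)) (c : Fin n → ℝ)
    (hc : ∀ u v, u ≠ v → 2 * c u ≤ U u v) :
    ∃ (T : WeightedTree) (node : Fin n → T.Node) (root : T.Node) (depth : ℝ),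
      (∀ u, T.dist root (node u) = depth - c u) ∧
      ∀ u v, u ≠ v → T.dist (node u) (node v) = U u v - c u - c v := by
  classical
  -- The levels needed: the heights at which elements are placed, and those at which two branches
  -- meet.
  obtain ⟨N, η, hη, hH⟩ := exists_monotone_enum
    (Finset.univ.image c ∪ Finset.univ.image fun e : Fin n × Fin n => U e.1 e.2 / 2)
  have hcl : ∀ u, ∃ i < N, η i = c u := fun u => hH _ (by simp)
  have hUl : ∀ u v, ∃ i < N, η i = U u v / 2 := fun u v => hH _ (by
    rw [Finset.mem_union]
    exact .inr (Finset.mem_image.mpr ⟨(u, v), by simp⟩))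
  choose l hlN hl using hcl
  have hlh : ∀ u, levelHeight η (levelNode hsymm htri N η u (l u)) = c u := by
    intro u
    rw [levelNode, dif_pos (hlN u)]
    exact hl u
  have hle := levelHeight_le (N := N) hsymm htri hη
  refine ⟨parentTree (levelRank_lt hsymm htri N η) (levelHeight η),
    fun u => levelNode hsymm htri N η u (l u), none, η N, fun u => ?_, fun u v huv => ?_⟩
  · refine (WeightedTree.dist_comm _ _ _).trans ?_
    refine (parentTree_dist_root _ hle _).trans ?_
    rw [hlh]
    rfl
  · refine le_antisymm ?_ ?_
    · obtain ⟨k, hkN, hk⟩ := hUl u v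
      -- Only the monotonicity of `η` is known, so the meeting index is raised to lie above both
      -- starting indices; by `hc` its height is still `U u v / 2`.
      let k' := max k (max (l u) (l v))
      have hk'N : k' < N := max_lt hkN (max_lt (hlN u) (hlN v))
      have hk' : η k' = U u v / 2 := by
        have h1 := hc u v huv
        have h2 := hc v u huv.symm
        rw [hsymm] at h2
        rw [hη.map_max, hη.map_max, hk, hl, hl, max_eq_left]
        exact max_le (by linarith) (by linarith)
      have hnode : levelNode hsymm htri N η u k' = levelNode hsymm htri N η v k' := by
        have : clusterRep hsymm htri (η k') u = clusterRep hsymm htri (η k') v :=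
          (clusterRep_eq_iff hsymm htri _ u v).mpr (.inr (by linarith))
        rw [levelNode, levelNode, dif_pos hk'N, dif_pos hk'N, this]
      have b1 := levelTree_between (N := N) hsymm htri hη u
        (show l u ≤ k' from (le_max_left _ _).trans (le_max_right _ _))
      have b2 := levelTree_between (N := N) hsymm htri hη v
        (show l v ≤ k' from (le_max_right _ _).trans (le_max_right _ _))
      rw [← hnode] at b2
      refine (parentTree_dist_le _ hle b1 b2).trans ?_
      rw [hlh, hlh, levelNode, dif_pos hk'N]
      simp only [levelHeight]
      linarith
    · obtain ⟨z, hz₁, hz₂, hz⟩ := parentTree_dist_eq (levelRank_lt hsymm htri N η) hle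
        (levelNode hsymm htri N η u (l u)) (levelNode hsymm htri N η v (l v))
      refine le_of_le_of_eq ?_ hz.symm
      rw [hlh, hlh]
      have hcl : ∀ w : Fin n, ∀ y ∈ Set.range (levelNode hsymm htri N η w), y ≠ none →
          levelParent hsymm htri N η y ∈ Set.range (levelNode hsymm htri N η w) := by
        rintro w _ ⟨i, rfl⟩ -
        exact ⟨i + 1, (levelParent_levelNode hsymm htri hη w i).symm⟩
      -- The node realizing the distance lies on both branches. It is either a common cluster at one
      -- level, which bounds `U u v` by twice its height, or the root, which is above every meeting
      -- height.
      obtain ⟨i, rfl⟩ := parentTree_mem_of_between _ hle hz₁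
        (S := Set.range (levelNode hsymm htri N η u)) ⟨_, rfl⟩ (hcl u)
      obtain ⟨j, hj⟩ := parentTree_mem_of_between _ hle hz₂
        (S := Set.range (levelNode hsymm htri N η v)) ⟨_, rfl⟩ (hcl v)
      suffices U u v ≤ 2 * levelHeight η (levelNode hsymm htri N η u i) by linarith
      by_cases hi : i < N
      · by_cases hjN : j < N
        · simp only [levelNode, dif_pos hi, dif_pos hjN, Option.some.injEq, Prod.mk.injEq,
            Fin.mk.injEq] at hj
          obtain ⟨hj, rfl⟩ := hj
          have := ((clusterRep_eq_iff hsymm htri _ v u).mp hj).resolve_left huv.symm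
          rw [levelNode, dif_pos hi, hsymm]
          exact this
        · simp [levelNode, hi, hjN] at hj
      · obtain ⟨k, hkN, hk⟩ := hUl u v
        rw [levelNode, dif_neg hi]
        have : η k ≤ η N := hη hkN.le
        simp only [levelHeight]
        linarith

end LevelTree

/-- The three-point characterization of ultrametrics. -/
theorem isUltrametric_of_strong_triangle {n : ℕ} {U : Mat n} (hD : IsDistanceMatrix U)
    (htri : ∀ u v w, U u w ≤ max (U u v) (U v w)) : IsUltrametric U := by
  obtain ⟨T, node, root, depth, h₁, h₂⟩ := exists_tree_of_strong_triangle hD.symm htri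
    (fun _ => 0) (fun u v _ => by simpa using hD.nonneg u v)
  refine ⟨T, node, root, depth, fun u => by simpa using h₁ u, fun u v => ?_⟩
  by_cases h : u = v
  · rw [h, hD.diag, T.dist_self]
  · simpa using (h₂ u v h).symm

/-- An ultrametric with shortened pendant edges is a tree metric. -/
theorem isTreeMetric_of_strong_triangle {n : ℕ} {U M : Mat n} (hsymm : ∀ u v, U u v = U v u)
    (htri : ∀ u v w, U u w ≤ max (U u v) (U v w)) (c : Fin n → ℝ)
    (hc : ∀ u v, u ≠ v → 2 * c u ≤ U u v) (hdiag : ∀ u, M u u = 0)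
    (hM : ∀ u v, u ≠ v → M u v = U u v - c u - c v) : IsTreeMetric M := by
  obtain ⟨T, node, root, depth, -, h₂⟩ := exists_tree_of_strong_triangle hsymm htri c hc
  refine ⟨T, node, fun u v => ?_⟩
  by_cases h : u = v
  · rw [h, hdiag, T.dist_self]
  · rw [hM u v h, h₂ u v h]

/-! ### The reduction for a fixed pivot -/

section Pivot

variable {n : ℕ}

/-- An upper bound for the distances from the pivot `a`. -/
noncomputable def radius (D : Mat n) (a : Fin n) : ℝ := ∑ u, D a u

/-- The smallest change of `x` to a distance of `u` and `v` that satisfies the triangle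
inequalities with the distances from the pivot `a`. -/
noncomputable def clamp (D : Mat n) (a u v : Fin n) (x : ℝ) : ℝ :=
  max (D a u - D a v) (max (D a v - D a u) (min (D a u + D a v) x))

/-- The shift of the Farris transform. -/
noncomputable def slack (D : Mat n) (a u v : Fin n) : ℝ := 2 * radius D a - D a u - D a v

/-- The instance of ultrametric fitting for the pivot `a`. -/
noncomputable def pivotQuery (D : Mat n) (a : Fin n) : Mat n := fun u v =>
  if u = v then 0 else clamp D a u v (D u v) + slack D a u v

/-- The tree metric obtained for the pivot `a` from the ultrametric `R`. -/
noncomputable def pivotTree (D : Mat n) (a : Fin n) (R : Mat n) : Mat n := fun u v =>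
  if u = v then 0 else clamp D a u v (R u v - slack D a u v)

variable {D : Mat n}

theorem le_radius (hD : IsDistanceMatrix D) (a u : Fin n) : D a u ≤ radius D a :=
  Finset.single_le_sum (f := fun u => D a u) (fun u _ => hD.nonneg a u) (Finset.mem_univ u)

theorem clamp_symm (a u v : Fin n) (x : ℝ) : clamp D a u v x = clamp D a v u x := by
  unfold clamp
  rw [max_left_comm, add_comm (D a u)]

theorem pivotQuery_isDistanceMatrix (hD : IsDistanceMatrix D) (a : Fin n) :
    IsDistanceMatrix (pivotQuery D a) where
  diag u := by simp [pivotQuery]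
  symm u v := by
    unfold pivotQuery slack
    rw [clamp_symm, hD.symm u v]
    simp only [eq_comm (a := u)]
    split_ifs
    · rfl
    · ring
  nonneg u v := by
    unfold pivotQuery
    split_ifs
    · exact le_rfl
    -- With the slack added, this lower bound becomes `2 * (radius D a - D a v)`.
    · have h₁ : D a u - D a v ≤ clamp D a u v (D u v) := le_max_left _ _
      have h₂ := le_radius hD a v
      unfold slack
      linarith

/-- Adding the slack turns the three clamping bounds into `2 * (r - D a u)`, `2 * (r - D a v)` and
`2 * r`, where `r` is the radius. Capping an ultrametric at a constant and then taking the maximum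
with weights of the two elements preserves the three-point condition, and those weights are exactly
what allows the pendant edge of `u` to be shortened by `r - D a u`. -/
theorem pivotTree_isTreeMetric (a : Fin n) {R : Mat n} (hR : IsUltrametric R) :
    IsTreeMetric (pivotTree D a R) := by
  refine isTreeMetric_of_strong_triangle
    (U := fun u v => max (2 * (radius D a - D a u)) (max (2 * (radius D a - D a v))
      (min (2 * radius D a) (R u v)))) (fun u v => ?_) (fun u v w => ?_)
    (fun u => radius D a - D a u) (fun u v _ => le_max_left _ _) (fun u => by simp [pivotTree])
    (fun u v huv => ?_)
  · rw [max_left_comm, hR.isTreeMetric.symm u v]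
  · have h := hR.strong_triangle u v w
    refine max_le (le_max_of_le_left (le_max_left _ _)) (max_le ?_ ?_)
    · exact le_max_of_le_right (le_max_of_le_right (le_max_left _ _))
    · rcases le_max_iff.mp h with h | h
      · exact le_max_of_le_left (le_max_of_le_right (le_max_of_le_right (min_le_min_left _ h)))
      · exact le_max_of_le_right (le_max_of_le_right (le_max_of_le_right (min_le_min_left _ h)))
  · simp only [pivotTree, if_neg huv, clamp, slack, ← max_sub_sub_right, ← min_sub_sub_right]
    rw [max_left_comm]
    congr 1
    · ring
    congr 1
    · ring
    congr 1 <;> ring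

/-! ### Counting disagreements -/

open Classical in
/-- The pairs on which the input and the tree metric `T` disagree, or one of whose elements has the
wrong distance from `a` in `T`. -/
noncomputable def badPairs (T D : Mat n) (a : Fin n) : Finset (Fin n × Fin n) :=
  Finset.univ.filter fun p => p.1 < p.2 ∧
    (T p.1 p.2 ≠ D p.1 p.2 ∨ T a p.1 ≠ D a p.1 ∨ T a p.2 ≠ D a p.2)

/-- The triangle inequalities of `T` for `a`, `u`, `v` place the value inside the clamping interval;
so clamping leaves pairs that are not bad untouched. -/
theorem clamp_of_isTreeMetric {T : Mat n} (hT : IsTreeMetric T) {a u v : Fin n}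
    (hu : T a u = D a u) (hv : T a v = D a v) (huv : T u v = D u v) :
    clamp D a u v (D u v) = D u v := by
  have h₁ := hT.triangle a u v
  have h₂ := hT.triangle a v u
  have h₃ := hT.triangle u a v
  rw [hT.symm u a] at h₃
  rw [hT.symm v u] at h₂
  rw [clamp, min_eq_right (by linarith), max_eq_right (b := D u v) (by linarith),
    max_eq_right (by linarith)]

open Classical in
/-- Some ultrametric is close to the query of the pivot `a`. -/
theorem exists_isUltrametric_near (hD : IsDistanceMatrix D) {T : Mat n} (hT : IsTreeMetric T)
    (a : Fin n) : ∃ S : Mat n, IsUltrametric S ∧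
      disagreements S (pivotQuery D a) ≤ (badPairs T D a).card := by
  -- The Farris transform of `T` on the elements with correct distance from `a`. All other elements
  -- are put at the maximal distance `2 * radius D a` from everything else, where they cannot
  -- violate the three-point condition.
  let S : Mat n := fun u v => if u = v then 0 else
    if T a u = D a u ∧ T a v = D a v then T u v + slack D a u v else 2 * radius D a
  have hr : 0 ≤ radius D a := Finset.sum_nonneg fun u _ => hD.nonneg a u
  have hle : ∀ u v, S u v ≤ 2 * radius D a := by
    intro u v
    simp only [S]
    split_ifs with h₁ h₂
    · linarith
    · have := hT.triangle u a v
      rw [hT.symm u a] at this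
      unfold slack
      linarith
    · exact le_rfl
  have hS : IsDistanceMatrix S := by
    refine ⟨fun u => by simp [S], fun u v => ?_, fun u v => ?_⟩
    · simp only [S, eq_comm (a := u), and_comm (a := T a u = _), hT.symm u v, slack,
        sub_right_comm]
    · simp only [S]
      split_ifs with h₁ h₂
      · exact le_rfl
      · have h₃ := hT.triangle a v u
        have h₄ := le_radius hD a v
        rw [hT.symm v u] at h₃
        unfold slack
        linarith
      · linarith
  have hbad : ∀ u v, u ≠ v → ¬ (T a u = D a u ∧ T a v = D a v) → S u v = 2 * radius D a := by
    intro u v huv h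
    simp only [S]
    rw [if_neg huv, if_neg h]
  refine ⟨S, isUltrametric_of_strong_triangle hS fun u v w => ?_, Finset.card_le_card ?_⟩
  · by_cases huw : u = w
    · rw [huw, hS.diag]
      exact le_max_of_le_left (hS.nonneg _ _)
    by_cases huv : u = v
    · rw [huv]
      exact le_max_right _ _
    by_cases hvw : v = w
    · rw [hvw]
      exact le_max_left _ _
    by_cases h₁ : T a u = D a u ∧ T a v = D a v
    · by_cases h₂ : T a v = D a v ∧ T a w = D a w
      · simp only [S]
        rw [if_neg huv, if_neg hvw, if_neg huw, if_pos h₁, if_pos h₂, if_pos ⟨h₁.1, h₂.2⟩]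
        -- Subtracting the three distances from `a` on both sides and adding `2 * radius D a` gives
        -- the three-point condition.
        have := hT.four_point a u v w
        simp only [slack]
        rcases le_max_iff.mp this with h | h
        · exact le_max_of_le_left (by linarith)
        · exact le_max_of_le_right (by linarith)
      · exact le_max_of_le_right ((hle u w).trans_eq (hbad v w hvw h₂).symm)
    · exact le_max_of_le_left ((hle u w).trans_eq (hbad u v huv h₁).symm)
  · rintro ⟨u, v⟩ hp
    simp only [Finset.mem_filter, Finset.mem_univ, true_and, badPairs] at hp ⊢
    refine ⟨hp.1, ?_⟩
    by_contra! h
    obtain ⟨huv, hu, hv⟩ := h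
    refine hp.2 ?_
    simp only [S, pivotQuery]
    rw [if_neg hp.1.ne, if_neg hp.1.ne, if_pos ⟨hu, hv⟩, clamp_of_isTreeMetric hT hu hv huv, huv]

/-- Transforming back costs at most the bad pairs. -/
theorem disagreements_pivotTree_le {T : Mat n} (hT : IsTreeMetric T) (a : Fin n) (R : Mat n) :
    disagreements (pivotTree D a R) D ≤
      disagreements R (pivotQuery D a) + (badPairs T D a).card := by
  classical
  refine (Finset.card_le_card ?_).trans (Finset.card_union_le _ _)
  rintro ⟨u, v⟩ hp
  simp only [Finset.mem_filter, Finset.mem_univ, true_and, badPairs, Finset.mem_union] at hp ⊢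
  by_contra! h
  obtain ⟨h₁, h₂⟩ := h
  obtain ⟨huv, hu, hv⟩ := h₂ hp.1
  refine hp.2 ?_
  -- The pair is not bad and `R` agrees with the query there: the slack cancels and neither clamping
  -- changes `D u v`.
  simp only [pivotTree]
  rw [if_neg hp.1.ne, h₁ hp.1, pivotQuery, if_neg hp.1.ne, clamp_of_isTreeMetric hT hu hv huv,
    add_sub_cancel_right, clamp_of_isTreeMetric hT hu hv huv]

open Classical in
theorem disagreements_eq_sum (A B : Mat n) :
    disagreements A B = ∑ u, ∑ v, if u < v ∧ A u v ≠ B u v then 1 else 0 := by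
  rw [disagreements, Finset.card_filter, Fintype.sum_prod_type]

/-- A disagreeing pair is itself bad for all `n` pivots. In addition, when one of its two elements
is the pivot, it spoils at most `n` pairs through the other element. So each disagreement is charged
at most `3 * n` times. -/
theorem sum_card_badPairs_le (hD : IsDistanceMatrix D) {T : Mat n} (hT : IsTreeMetric T) :
    ∑ a, (badPairs T D a).card ≤ n * (3 * disagreements T D) := by
  classical
  let b : Fin n → Fin n → ℕ := fun u v => if T u v ≠ D u v then 1 else 0
  have hb : ∀ u v, b u v = b v u := fun u v => by simp only [b, hT.symm u v, hD.symm u v]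
  have hb0 : ∀ u, b u u = 0 := fun u => by simp [b, hT.diag, hD.diag]
  have hdis : disagreements T D = ∑ u, ∑ v, if u < v then b u v else 0 := by
    rw [disagreements_eq_sum]
    simp only [b, ite_and]
  have h₁ : ∀ a, (badPairs T D a).card ≤ disagreements T D + ∑ u, n * b a u := by
    intro a
    have h₂ : (badPairs T D a).card ≤
        ∑ u, ∑ v, if u < v then b u v + (b a u + b a v) else 0 := by
      rw [badPairs, Finset.card_filter, Fintype.sum_prod_type]
      refine Finset.sum_le_sum fun u _ => Finset.sum_le_sum fun v _ => ?_
      simp only [b]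
      split_ifs <;> simp_all
    refine h₂.trans ?_
    have h₃ : ∑ u, ∑ v, (if u < v then b u v + (b a u + b a v) else 0) =
        disagreements T D + ((∑ u, ∑ v, if u < v then b a u else 0) +
          ∑ u, ∑ v, if u < v then b a v else 0) := by
      rw [hdis]
      simp only [← Finset.sum_add_distrib]
      refine Finset.sum_congr rfl fun u _ => Finset.sum_congr rfl fun v _ => ?_
      split_ifs <;> simp
    rw [h₃]
    refine Nat.add_le_add_left ?_ _
    -- After the swap, the term of `u` collects the pairs in which `u` comes first or second, at
    -- most one for each `v`.
    rw [Finset.sum_comm (f := fun u v => if u < v then b a v else 0), ← Finset.sum_add_distrib]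
    refine Finset.sum_le_sum fun u _ => ?_
    rw [← Finset.sum_add_distrib]
    refine (Finset.sum_le_card_nsmul _ _ (b a u) fun v _ => ?_).trans_eq (by simp)
    rcases lt_or_ge u v with h | h
    · simp [h, h.not_gt]
    · split_ifs <;> simp
      omega
  have h₄ : ∑ a, ∑ u, b a u = 2 * disagreements T D := by
    have h₅ : ∑ a, ∑ u, b a u = ∑ a, ∑ u, ((if a < u then b a u else 0) +
        if u < a then b u a else 0) := by
      refine Finset.sum_congr rfl fun a _ => Finset.sum_congr rfl fun u _ => ?_
      rcases lt_trichotomy a u with h | rfl | h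
      · simp [h, h.not_gt]
      · simp [hb0]
      · simp [h, h.not_gt, hb u a]
    rw [h₅]
    simp only [Finset.sum_add_distrib]
    rw [Finset.sum_comm (f := fun a u => if u < a then b u a else 0), hdis, two_mul]
  calc ∑ a, (badPairs T D a).card ≤ ∑ a, (disagreements T D + ∑ u, n * b a u) :=
        Finset.sum_le_sum fun a _ => h₁ a
    _ = n * disagreements T D + n * ∑ a, ∑ u, b a u := by
        simp [Finset.sum_add_distrib, Finset.mul_sum]
    _ = n * (3 * disagreements T D) := by rw [h₄]; ring

/-- Some pivot is good. -/
theorem exists_card_badPairs_le (hn : 0 < n) (hD : IsDistanceMatrix D) {T : Mat n}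
    (hT : IsTreeMetric T) : ∃ a, (badPairs T D a).card ≤ 3 * disagreements T D := by
  by_contra! h
  have := Finset.sum_lt_sum_of_nonempty (s := Finset.univ) ⟨⟨0, hn⟩, Finset.mem_univ _⟩
    fun a _ => h a
  rw [Finset.sum_const, Finset.card_univ, Fintype.card_fin, smul_eq_mul] at this
  exact absurd (sum_card_badPairs_le hD hT) (not_le.mpr this)

/-- For every tree metric, one of the pivots yields a tree metric that is at most `6 ρ` times as
expensive. -/
theorem exists_pivotTree_le (hn : 0 < n) (hD : IsDistanceMatrix D) {ρ : ℝ} (hρ : 1 ≤ ρ)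
    {R : Fin n → Mat n} (hR : ∀ a, IsApproxSolution IsUltrametric ρ (pivotQuery D a) (R a))
    {T : Mat n} (hT : IsTreeMetric T) :
    ∃ a, (disagreements (pivotTree D a (R a)) D : ℝ) ≤ 6 * ρ * disagreements T D := by
  obtain ⟨a, ha⟩ := exists_card_badPairs_le hn hD hT
  obtain ⟨S, hS, hSa⟩ := exists_isUltrametric_near hD hT a
  refine ⟨a, ?_⟩
  have h₁ : (disagreements (pivotTree D a (R a)) D : ℝ) ≤
      disagreements (R a) (pivotQuery D a) + (badPairs T D a).card :=
    mod_cast disagreements_pivotTree_le hT a (R a)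
  have h₂ := (hR a).2 S hS
  have h₃ : (disagreements S (pivotQuery D a) : ℝ) ≤ (badPairs T D a).card := mod_cast hSa
  have h₄ : ((badPairs T D a).card : ℝ) ≤ 3 * disagreements T D := mod_cast ha
  have h₅ := mul_le_mul_of_nonneg_left h₃ (by linarith : 0 ≤ ρ)
  have h₆ := mul_le_mul_of_nonneg_left h₄ (by linarith : 0 ≤ ρ)
  -- The loss in transforming back carries no factor `ρ`; since `1 ≤ ρ`, it is absorbed into the
  -- second half of `6 * ρ`.
  have h₇ : (3 * disagreements T D : ℝ) ≤ ρ * (3 * disagreements T D) :=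
    le_mul_of_one_le_left (by positivity) hρ
  linarith

end Pivot

/-! ### Executions with bounded cost -/

/-- Program `p` halts from `s` in `s'` within `B` steps. -/
def Runs (O : Oracle) (p : Prog) (s s' : Store) (B : ℕ) : Prop := ∃ c ≤ B, Exec O p s s' c

section Rules

variable {O : Oracle}

theorem Runs.mono {p : Prog} {s s' : Store} {B C : ℕ} (h : Runs O p s s' B) (hBC : B ≤ C) :
    Runs O p s s' C := by
  obtain ⟨c, hc, h⟩ := h
  exact ⟨c, hc.trans hBC, h⟩

theorem Runs.nop (s : Store) : Runs O .nop s s 1 := ⟨_, le_rfl, .nop s⟩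

theorem Runs.setN (s : Store) (a : ℕ) (i e : NExp) :
    Runs O (.setN a i e) s (s.setInt a (i.eval s) (e.eval s)) (i.size + e.size + 1) :=
  ⟨_, le_rfl, .setN s a i e⟩

theorem Runs.setR (s : Store) (a : ℕ) (i j : NExp) (e : RExp) :
    Runs O (.setR a i j e) s (s.setReal a (i.eval s) (j.eval s) (e.eval s))
      (i.size + j.size + e.size + 1) :=
  ⟨_, le_rfl, .setR s a i j e⟩

theorem Runs.seq {p q : Prog} {s s' s'' : Store} {B C : ℕ} (h : Runs O p s s' B)
    (h' : Runs O q s' s'' C) : Runs O (.seq p q) s s'' (B + C) := by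
  obtain ⟨c, hc, h⟩ := h
  obtain ⟨d, hd, h'⟩ := h'
  exact ⟨c + d, add_le_add hc hd, .seq h h'⟩

theorem Runs.ite_true {b : BExp} {p q : Prog} {s s' : Store} {B : ℕ} (hb : b.holds s)
    (h : Runs O p s s' B) : Runs O (.ite b p q) s s' (b.size + B) := by
  obtain ⟨c, hc, h⟩ := h
  exact ⟨_, Nat.add_le_add_left hc _, .ite_true hb h⟩

theorem Runs.ite_false {b : BExp} {p q : Prog} {s s' : Store} {B : ℕ} (hb : ¬ b.holds s)
    (h : Runs O q s s' B) : Runs O (.ite b p q) s s' (b.size + B) := by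
  obtain ⟨c, hc, h⟩ := h
  exact ⟨_, Nat.add_le_add_left hc _, .ite_false hb h⟩

theorem Runs.loop_true {b : BExp} {p : Prog} {s s' s'' : Store} {B C : ℕ} (hb : b.holds s)
    (h : Runs O p s s' B) (h' : Runs O (.loop b p) s' s'' C) :
    Runs O (.loop b p) s s'' (b.size + B + C) := by
  obtain ⟨c, hc, h⟩ := h
  obtain ⟨d, hd, h'⟩ := h'
  exact ⟨_, add_le_add (Nat.add_le_add_left hc _) hd, .loop_true hb h h'⟩

theorem Runs.loop_false {b : BExp} {p : Prog} {s : Store} (hb : ¬ b.holds s) :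
    Runs O (.loop b p) s s b.size := ⟨_, le_rfl, .loop_false hb⟩

/-- The size is a variable of its own, so that the type of the answer does not mention the store. -/
theorem Runs.oracle {k : NExp} {src dst : ℕ} {s : Store} {n : ℕ} (hk : k.eval s = n) {R : Mat n}
    {c : ℕ} (h : O n (s.read src n) = some (R, c)) :
    Runs O (.oracle k src dst) s (s.write dst R) (k.size + 2 * n ^ 2 + c + 1) := by
  subst hk
  exact ⟨_, le_rfl, .oracle h⟩

end Rules

/-! ### Stores -/

namespace Store

variable (s : Store)

@[simp] theorem setReal_int (a i j : ℕ) (x : ℝ) : (s.setReal a i j x).int = s.int := rfl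

@[simp] theorem setInt_real (a i x : ℕ) : (s.setInt a i x).real = s.real := rfl

@[simp] theorem write_int (a : ℕ) {n : ℕ} (M : Mat n) : (s.write a M).int = s.int := rfl

@[simp] theorem setInt_int_self (a i x : ℕ) : (s.setInt a i x).int a i = x := by simp [setInt]

@[simp] theorem setInt_int_of_ne {a b : ℕ} (h : b ≠ a) (i x : ℕ) :
    (s.setInt a i x).int b = s.int b := by
  funext k
  simp [setInt, h]

@[simp] theorem setReal_real_self (a i j : ℕ) (x : ℝ) :
    (s.setReal a i j x).real a i j = x := by simp [setReal]

@[simp] theorem setReal_real_of_ne {a b : ℕ} (h : b ≠ a) (i j : ℕ) (x : ℝ) :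
    (s.setReal a i j x).real b = s.real b := by
  funext k l
  simp [setReal, h]

@[simp] theorem write_real_of_ne {a b : ℕ} (h : b ≠ a) {n : ℕ} (M : Mat n) :
    (s.write a M).real b = s.real b := by
  funext k l
  simp [write, h]

@[simp] theorem write_real_self (a : ℕ) {n : ℕ} (M : Mat n) (u v : Fin n) :
    (s.write a M).real a u v = M u v := by
  simp [write]

@[simp] theorem setReal_same (a i j : ℕ) : s.setReal a i j (s.real a i j) = s := by
  cases s
  simp only [setReal, mk.injEq, true_and]
  funext b k l
  split_ifs with h
  · obtain ⟨rfl, rfl, rfl⟩ := h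
    rfl
  · rfl

@[simp] theorem setReal_setReal (a i j : ℕ) (x y : ℝ) :
    (s.setReal a i j x).setReal a i j y = s.setReal a i j y := by
  simp only [setReal, mk.injEq, true_and]
  funext b k l
  split_ifs <;> rfl

end Store

/-! ### Counting loops -/

/-- The integer variable number `a`. -/
def nvar (a : ℕ) : NExp := .cell a (.const 0)

@[simp] theorem nvar_eval (a : ℕ) (s : Store) : (nvar a).eval s = s.int a 0 := rfl

@[simp] theorem nvar_size (a : ℕ) : (nvar a).size = 2 := rfl

/-- Run `p` with variable `v` ranging over the numbers below the input size. -/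
def forLoop (v : ℕ) (p : Prog) : Prog :=
  .seq (.setN v (.const 0) (.const 0))
    (.loop (.leN (.add (nvar v) (.const 1)) (nvar 0))
      (.seq p (.setN v (.const 0) (.add (nvar v) (.const 1)))))

/-- `Inv i` describes the store before round `i`, counter included, which is why `step` speaks of
the store after the increment. A round costs `7` for the test and `6` for the increment besides the
body; the final `10` is the initialization and the failing test. -/
theorem Runs.forLoop {O : Oracle} {v : ℕ} {p : Prog} {n B : ℕ} (Inv : ℕ → Store → Prop)
    (hInv : ∀ i s, Inv i s → s.int 0 0 = n ∧ s.int v 0 = i)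
    (step : ∀ i < n, ∀ s, Inv i s →
      ∃ s', Runs O p s s' B ∧ s'.int v 0 = i ∧ Inv (i + 1) (s'.setInt v 0 (i + 1)))
    {s : Store} (h0 : Inv 0 (s.setInt v 0 0)) :
    ∃ s', Runs O (forLoop v p) s s' (n * (B + 13) + 10) ∧ Inv n s' := by
  have key : ∀ m i s, i + m = n → Inv i s →
      ∃ s', Runs O (.loop (.leN (.add (nvar v) (.const 1)) (nvar 0))
        (.seq p (.setN v (.const 0) (.add (nvar v) (.const 1))))) s s' (m * (B + 13) + 7) ∧
        Inv n s' := by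
    intro m
    induction m with
    | zero =>
      intro i s hi hs
      obtain rfl : i = n := hi
      refine ⟨s, (Runs.loop_false ?_).mono ?_, hs⟩
      · simp [BExp.holds, NExp.eval, hInv i s hs]
      · simp [BExp.size, NExp.size]
    | succ m ih =>
      intro i s hi hs
      obtain ⟨s', hr, hv, hs'⟩ := step i (by omega) s hs
      obtain ⟨s'', hr', hs''⟩ := ih (i + 1) _ (by omega) hs'
      refine ⟨s'', (Runs.loop_true (C := m * (B + 13) + 7) ?_
        (hr.seq (Runs.setN _ _ _ _)) ?_).mono ?_, hs''⟩
      · simp only [BExp.holds, NExp.eval, hInv i s hs, nvar_eval]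
        omega
      · simpa only [NExp.eval, nvar_eval, hv] using hr'
      · simp only [BExp.size, NExp.size, nvar_size]
        ring_nf
        omega
  obtain ⟨s', hr, hs'⟩ := key n 0 _ (by omega) h0
  refine ⟨s', (Runs.seq (Runs.setN _ _ _ _) hr).mono ?_, hs'⟩
  simp only [NExp.size]
  omega

/-- Run `p` for all pairs of values of the variables `1` and `2`. -/
def gridLoop (p : Prog) : Prog := forLoop 1 (forLoop 2 p)

/-- The cost of a grid loop whose body has cost `B`. -/
def gridCost (n B : ℕ) : ℕ := n * (n * (B + 13) + 23) + 10

/-- In `Inv i j`, the rows before `i` and the first `j` entries of row `i` have been treated; `row`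
identifies a finished row with the start of the next. The invariant must tolerate changes of both
grid variables, since the loops overwrite them. -/
theorem Runs.gridLoop {O : Oracle} {p : Prog} {n B : ℕ} (Inv : ℕ → ℕ → Store → Prop)
    (hsize : ∀ i j s, Inv i j s → s.int 0 0 = n)
    (hset₁ : ∀ i j s x, Inv i j s → Inv i j (s.setInt 1 0 x))
    (hset₂ : ∀ i j s x, Inv i j s → Inv i j (s.setInt 2 0 x))
    (row : ∀ i s, Inv i n s → Inv (i + 1) 0 s)
    (step : ∀ (u v : Fin n) s, Inv u v s → s.int 1 0 = u → s.int 2 0 = v →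
      ∃ s', Runs O p s s' B ∧ s'.int 1 0 = u ∧ s'.int 2 0 = v ∧ Inv u (v + 1) s')
    {s : Store} (h0 : Inv 0 0 s) :
    ∃ s', Runs O (gridLoop p) s s' (gridCost n B) ∧ Inv n 0 s' := by
  have inner : ∀ i < n, ∀ s, Inv i 0 s ∧ s.int 1 0 = i →
      ∃ s', Runs O (L0Fit.forLoop 2 p) s s' (n * (B + 13) + 10) ∧ s'.int 1 0 = i ∧
        Inv (i + 1) 0 (s'.setInt 1 0 (i + 1)) ∧ (s'.setInt 1 0 (i + 1)).int 1 0 = i + 1 := by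
    intro i hi s h
    have body : ∀ j < n, ∀ s, Inv i j s ∧ s.int 1 0 = i ∧ s.int 2 0 = j →
        ∃ s', Runs O p s s' B ∧ s'.int 2 0 = j ∧ Inv i (j + 1) (s'.setInt 2 0 (j + 1)) ∧
          (s'.setInt 2 0 (j + 1)).int 1 0 = i ∧ (s'.setInt 2 0 (j + 1)).int 2 0 = j + 1 := by
      intro j hj s h
      obtain ⟨s', hr, h₁, h₂, hs'⟩ := step ⟨i, hi⟩ ⟨j, hj⟩ s h.1 h.2.1 h.2.2
      exact ⟨s', hr, h₂, hset₂ _ _ _ _ hs', by simpa using h₁, by simp⟩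
    obtain ⟨s', hr, hs', hi', -⟩ := Runs.forLoop _ (fun j s h => ⟨hsize _ _ _ h.1, h.2.2⟩) body
      (s := s) ⟨hset₂ _ _ _ _ h.1, by simp [h.2], by simp⟩
    exact ⟨s', hr, hi', hset₁ _ _ _ _ (row _ _ hs'), by simp⟩
  obtain ⟨s', hr, hs', -⟩ := Runs.forLoop _ (fun i s h => ⟨hsize _ _ _ h.1, h.2⟩) inner
    (s := s) ⟨hset₁ _ _ _ _ h0, by simp⟩
  exact ⟨s', hr, hs'⟩

/-- Outside the two grid variables, the integer memory is unchanged. -/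
def SameInt (s s' : Store) : Prop := ∀ a, a ≠ 1 → a ≠ 2 → s'.int a = s.int a

/-- Outside array `d` and the scratch array `6`, the real memory is unchanged. -/
def SameReal (d : ℕ) (s s' : Store) : Prop := ∀ a, a ≠ 6 → a ≠ d → s'.real a = s.real a

/-- A grid loop that fills the array `d`. -/
theorem Runs.fill {O : Oracle} {p : Prog} {n d B : ℕ} (hd : d ≠ 6) (f : Mat n) {s : Store}
    (hn : s.int 0 0 = n)
    (hp : ∀ (s₁ : Store) (u v : Fin n), SameInt s s₁ → SameReal d s s₁ →
      s₁.int 1 0 = u → s₁.int 2 0 = v →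
      ∃ x, Runs O p s₁ ((s₁.setReal 6 0 0 x).setReal d u v (f u v)) B) :
    ∃ s', Runs O (L0Fit.gridLoop p) s s' (gridCost n B) ∧ SameInt s s' ∧ SameReal d s s' ∧
      ∀ u v : Fin n, s'.real d u v = f u v := by
  let Inv : ℕ → ℕ → Store → Prop := fun i j s' => SameInt s s' ∧ SameReal d s s' ∧
    ∀ u v : Fin n, (u.1 < i ∨ u.1 = i ∧ v.1 < j) → s'.real d u v = f u v
  have step : ∀ (u v : Fin n) s₁, Inv u v s₁ → s₁.int 1 0 = u → s₁.int 2 0 = v →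
      ∃ s', Runs O p s₁ s' B ∧ s'.int 1 0 = u ∧ s'.int 2 0 = v ∧ Inv u (v + 1) s' := by
    intro u v s₁ h h₁ h₂
    obtain ⟨x, hr⟩ := hp s₁ u v h.1 h.2.1 h₁ h₂
    refine ⟨_, hr, by simpa using h₁, by simpa using h₂, fun a ha₁ ha₂ => ?_, fun a ha₁ ha₂ => ?_,
      fun u' v' h' => ?_⟩
    · simpa using h.1 a ha₁ ha₂
    · simpa [ha₁, ha₂] using h.2.1 a ha₁ ha₂
    · by_cases he : u' = u ∧ v' = v
      · rw [he.1, he.2, Store.setReal_real_self]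
      · have : ¬ (u'.1 = u.1 ∧ v'.1 = v.1) := by rwa [← Fin.ext_iff, ← Fin.ext_iff]
        simp only [Store.setReal, true_and, if_neg this, hd, false_and, if_false]
        exact h.2.2 u' v' (by omega)
  obtain ⟨s', hr, hi, hre, h⟩ := Runs.gridLoop Inv
    (fun i j s' h => by rw [h.1 0 (by decide) (by decide), hn])
    (fun i j s' x h => ⟨fun a h₁ h₂ => by simp [h₁, h.1 a h₁ h₂], h.2⟩)
    (fun i j s' x h => ⟨fun a h₁ h₂ => by simp [h₂, h.1 a h₁ h₂], h.2⟩)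
    (fun i s' h => ⟨h.1, h.2.1, fun u v huv => h.2.2 u v (by have := v.2; omega)⟩)
    step (s := s) ⟨fun a _ _ => rfl, fun a _ _ => rfl, fun u v h => by omega⟩
  exact ⟨s', hr, hi, hre, fun u v => h u v (.inl u.2)⟩

/-! ### The program

Integer variables: `0` the size, `1` and `2` the grid variables, `3` the pivot, `4` the number of
disagreements of the current tree metric, `5` the smallest such number so far.  Real arrays: `0` the
input, `1` the best tree metric so far, `2` the query, `3` the radius, `4` the answer of the oracle,
`5` the current tree metric, `6` scratch. -/

/-- The scratch cell. -/
def scratch : RExp := .cell 6 (.const 0) (.const 0)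

/-- The cell of the radius. -/
def radiusCell : RExp := .cell 3 (.const 0) (.const 0)

/-- The distance from the pivot to the element in integer variable `v`. -/
def pivotDist (v : ℕ) : RExp := .cell 0 (nvar 3) (nvar v)

/-- Entry of real array `a` at the grid variables. -/
def gridCell (a : ℕ) : RExp := .cell a (nvar 1) (nvar 2)

/-- The slack at the grid variables. -/
def slackExp : RExp := .sub (.sub (.add radiusCell radiusCell) (pivotDist 1)) (pivotDist 2)

/-- Store the radius. -/
def radiusProg : Prog :=
  .seq (.setR 3 (.const 0) (.const 0) (.ofNat (.const 0)))
    (forLoop 2 (.setR 3 (.const 0) (.const 0) (.add radiusCell (pivotDist 2))))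

/-- Lower the scratch cell to `e`. -/
def minProg (e : RExp) : Prog :=
  .ite (.leR e scratch) (.setR 6 (.const 0) (.const 0) e) .nop

/-- Raise the scratch cell to `e`. -/
def maxProg (e : RExp) : Prog :=
  .ite (.leR scratch e) (.setR 6 (.const 0) (.const 0) e) .nop

/-- Put the clamped value of `e` into the scratch cell. -/
def clampProg (e : RExp) : Prog :=
  .seq (.setR 6 (.const 0) (.const 0) e)
    (.seq (minProg (.add (pivotDist 1) (pivotDist 2)))
      (.seq (maxProg (.sub (pivotDist 2) (pivotDist 1)))
        (maxProg (.sub (pivotDist 1) (pivotDist 2)))))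

/-- Assign to the entry of array `d` at the grid variables, with `0` on the diagonal. -/
def offDiagProg (d : ℕ) (e : RExp) : Prog :=
  .ite (.and (.leN (nvar 1) (nvar 2)) (.leN (nvar 2) (nvar 1)))
    (.setR d (nvar 1) (nvar 2) (.ofNat (.const 0))) (.setR d (nvar 1) (nvar 2) e)

/-- Compute an entry of the query. -/
def queryProg : Prog := .seq (clampProg (gridCell 0)) (offDiagProg 2 (.add scratch slackExp))

/-- Compute an entry of the current tree metric. -/
def treeProg : Prog := .seq (clampProg (.sub (gridCell 4) slackExp)) (offDiagProg 5 scratch)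

/-- Count a disagreement. -/
def countProg : Prog :=
  .ite (.and (.not (.leN (nvar 2) (nvar 1)))
      (.not (.and (.leR (gridCell 5) (gridCell 0)) (.leR (gridCell 0) (gridCell 5)))))
    (.setN 4 (.const 0) (.add (nvar 4) (.const 1))) .nop

/-- Keep the current tree metric if it is the first one or better than those before. -/
def keepProg : Prog :=
  .ite (.and (.leN (.const 1) (nvar 3)) (.leN (nvar 5) (nvar 4))) .nop
    (.seq (gridLoop (.setR 1 (nvar 1) (nvar 2) (gridCell 5))) (.setN 5 (.const 0) (nvar 4)))

/-- Treat one pivot. -/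
def pivotProg : Prog :=
  .seq radiusProg (.seq (gridLoop queryProg) (.seq (.oracle (nvar 0) 2 4)
    (.seq (gridLoop treeProg) (.seq (.setN 4 (.const 0) (.const 0))
      (.seq (gridLoop countProg) keepProg)))))

/-- Fit a tree metric: try all pivots and keep the best result. -/
def fitTreeProg : Prog := forLoop 3 pivotProg

/-! ### Correctness -/

section Correctness

variable {O : Oracle}

theorem runs_minProg (e : RExp) (s : Store) :
    Runs O (minProg e) s (s.setReal 6 0 0 (min (e.eval s) (s.real 6 0 0))) (2 * e.size + 7) := by
  by_cases h : e.eval s ≤ s.real 6 0 0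
  · rw [min_eq_left h]
    refine (Runs.ite_true (by exact h) (Runs.setR _ _ _ _ _)).mono ?_
    simp only [BExp.size, RExp.size, NExp.size, scratch]
    omega
  · rw [min_eq_right (le_of_not_ge h), Store.setReal_same]
    refine (Runs.ite_false (by exact h) (Runs.nop _)).mono ?_
    simp only [BExp.size, RExp.size, NExp.size, scratch]
    omega

theorem runs_maxProg (e : RExp) (s : Store) :
    Runs O (maxProg e) s (s.setReal 6 0 0 (max (e.eval s) (s.real 6 0 0))) (2 * e.size + 7) := by
  by_cases h : s.real 6 0 0 ≤ e.eval s
  · rw [max_eq_left h]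
    refine (Runs.ite_true (by exact h) (Runs.setR _ _ _ _ _)).mono ?_
    simp only [BExp.size, RExp.size, NExp.size, scratch]
    omega
  · rw [max_eq_right (le_of_not_ge h), Store.setReal_same]
    refine (Runs.ite_false (by exact h) (Runs.nop _)).mono ?_
    simp only [BExp.size, RExp.size, NExp.size, scratch]
    omega

variable {n : ℕ} {D : Mat n} {a : Fin n} {s : Store}

theorem pivotDist_eval (hD : ∀ u v : Fin n, s.real 0 u v = D u v) (ha : s.int 3 0 = a) {w : ℕ}
    {u : Fin n} (hu : s.int w 0 = u) : (pivotDist w).eval s = D a u := by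
  simp only [pivotDist, RExp.eval, nvar_eval, ha, hu, hD]

theorem slackExp_eval (hD : ∀ u v : Fin n, s.real 0 u v = D u v) (ha : s.int 3 0 = a)
    (hr : s.real 3 0 0 = radius D a) {u v : Fin n} (hu : s.int 1 0 = u) (hv : s.int 2 0 = v) :
    slackExp.eval s = slack D a u v := by
  simp only [slackExp, RExp.eval, pivotDist_eval hD ha hu, pivotDist_eval hD ha hv, radiusCell,
    NExp.eval, hr, slack]
  ring

/-- The program evaluates the nested `min` and `max` of `clamp` from the inside outwards; `e` is
read before the scratch cell changes. -/
theorem runs_clampProg (hD : ∀ u v : Fin n, s.real 0 u v = D u v) (ha : s.int 3 0 = a)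
    {u v : Fin n} (hu : s.int 1 0 = u) (hv : s.int 2 0 = v) (e : RExp) :
    Runs O (clampProg e) s (s.setReal 6 0 0 (clamp D a u v (e.eval s))) (e.size + 90) := by
  have hd : ∀ (w : ℕ) (z : Fin n) (x : ℝ), s.int w 0 = z →
      (pivotDist w).eval (s.setReal 6 0 0 x) = D a z := fun w z x hz =>
    pivotDist_eval (by simpa using hD) (by simpa using ha) (by simpa using hz)
  have h := ((Runs.setR (O := O) s 6 (.const 0) (.const 0) e).seq
    ((runs_minProg _ _).seq ((runs_maxProg _ _).seq (runs_maxProg _ _)))).mono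
      (C := e.size + 90) (p := clampProg e) (by
        simp only [RExp.size, NExp.size, pivotDist, nvar_size]
        omega)
  unfold clamp
  simpa only [NExp.eval, RExp.eval, Store.setReal_real_self, Store.setReal_setReal,
    hd 1 u _ hu, hd 2 v _ hv] using h

theorem runs_offDiagProg {u v : Fin n} (hu : s.int 1 0 = u) (hv : s.int 2 0 = v) (d : ℕ)
    (e : RExp) : Runs O (offDiagProg d e) s
      (s.setReal d u v (if u = v then 0 else e.eval s)) (e.size + 20) := by
  unfold offDiagProg
  split_ifs with h
  · have hb : BExp.holds s (.and (.leN (nvar 1) (nvar 2)) (.leN (nvar 2) (nvar 1))) := by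
      simp [BExp.holds, hu, hv, h]
    have h := (Runs.ite_true (O := O) (q := .setR d (nvar 1) (nvar 2) e) hb
      (Runs.setR s d (nvar 1) (nvar 2) (.ofNat (.const 0)))).mono (C := e.size + 20) (by
        simp only [BExp.size, RExp.size, NExp.size, nvar_size]
        omega)
    simpa only [nvar_eval, hu, hv, RExp.eval, NExp.eval, Nat.cast_zero] using h
  · have hb : ¬ BExp.holds s (.and (.leN (nvar 1) (nvar 2)) (.leN (nvar 2) (nvar 1))) := by
      simp only [BExp.holds, nvar_eval, hu, hv]
      exact fun h' => h (Fin.ext (le_antisymm h'.1 h'.2))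
    have h := (Runs.ite_false (O := O) (p := .setR d (nvar 1) (nvar 2) (.ofNat (.const 0))) hb
      (Runs.setR s d (nvar 1) (nvar 2) e)).mono (C := e.size + 20) (by
        simp only [BExp.size, nvar_size]
        omega)
    simpa only [nvar_eval, hu, hv] using h

theorem runs_radiusProg (hn : s.int 0 0 = n) (hD : ∀ u v : Fin n, s.real 0 u v = D u v)
    (ha : s.int 3 0 = a) :
    ∃ s', Runs O radiusProg s s' (n * 25 + 15) ∧ SameInt s s' ∧ SameReal 3 s s' ∧
      s'.real 3 0 0 = radius D a := by
  -- The invariant: the radius cell holds the partial sum over the first `j` elements.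
  have step : ∀ j < n, ∀ s₁ : Store, (SameInt s s₁ ∧ s₁.int 2 0 = j ∧ SameReal 3 s s₁ ∧
      s₁.real 3 0 0 = ∑ k ∈ Finset.range j, s.real 0 a k) →
      ∃ s', Runs O (.setR 3 (.const 0) (.const 0) (.add radiusCell (pivotDist 2))) s₁ s' 12 ∧
        s'.int 2 0 = j ∧ (SameInt s (s'.setInt 2 0 (j + 1)) ∧
          (s'.setInt 2 0 (j + 1)).int 2 0 = j + 1 ∧ SameReal 3 s (s'.setInt 2 0 (j + 1)) ∧
          (s'.setInt 2 0 (j + 1)).real 3 0 0 = ∑ k ∈ Finset.range (j + 1), s.real 0 a k) := by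
    rintro j hj s₁ ⟨h₁, h₂, h₃, h₄⟩
    refine ⟨_, Runs.setR _ _ _ _ _, by simpa using h₂, fun b hb hb' => ?_, by simp,
      fun b hb hb' => ?_, ?_⟩
    · simpa [hb'] using h₁ b hb hb'
    · simpa [hb'] using h₃ b hb hb'
    · rw [Finset.sum_range_succ, ← h₄]
      simp only [NExp.eval, RExp.eval, Store.setInt_real, Store.setReal_real_self, radiusCell,
        pivotDist, nvar_eval, h₂, h₃ 0 (by decide) (by decide), h₁ 3 (by decide) (by decide), ha]
  obtain ⟨s', hr, h₁, -, h₂, h₃⟩ := Runs.forLoop (n := n) _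
    (fun j s₁ h => ⟨(congrFun (h.1 0 (by decide) (by decide)) 0).trans hn, h.2.1⟩) step
    (s := s.setReal 3 0 0 0)
    ⟨fun b hb hb' => by simp [hb'], by simp, fun b hb hb' => by simp [hb'], by simp⟩
  refine ⟨s', (Runs.seq (s' := s.setReal 3 0 0 0) (B := 5) ?_ hr).mono (by omega), h₁, h₂, ?_⟩
  · simpa [RExp.eval, NExp.eval, RExp.size, NExp.size] using
      Runs.setR (O := O) s 3 (.const 0) (.const 0) (.ofNat (.const 0))
  · rw [h₃, Finset.sum_range]
    simp only [hD, radius]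

theorem runs_queryLoop (hn : s.int 0 0 = n) (hD : ∀ u v : Fin n, s.real 0 u v = D u v)
    (ha : s.int 3 0 = a) (hr : s.real 3 0 0 = radius D a) :
    ∃ s', Runs O (gridLoop queryProg) s s' (gridCost n 140) ∧ SameInt s s' ∧ SameReal 2 s s' ∧
      ∀ u v : Fin n, s'.real 2 u v = pivotQuery D a u v := by
  refine Runs.fill (by decide) (pivotQuery D a) hn fun s₁ u v hi hre hu hv => ?_
  have hD₁ : ∀ u v : Fin n, s₁.real 0 u v = D u v := by simpa [hre 0] using hD
  have ha₁ : s₁.int 3 0 = a := by simpa [hi 3] using ha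
  have hr₁ : s₁.real 3 0 0 = radius D a := by simpa [hre 3] using hr
  have h₁ := runs_clampProg (O := O) hD₁ ha₁ hu hv (gridCell 0)
  have h₂ := runs_offDiagProg (O := O) (u := u) (v := v)
    (s := s₁.setReal 6 0 0 (clamp D a u v (RExp.eval s₁ (gridCell 0)))) hu hv 2 (.add scratch slackExp)
  have h := (h₁.seq h₂).mono (p := queryProg) (C := 140) (by
        simp only [RExp.size, NExp.size, gridCell, slackExp, scratch, radiusCell, pivotDist,
          nvar_size]
        omega)
  rw [RExp.eval, slackExp_eval (by simpa using hD₁) (by simpa using ha₁) (by simpa using hr₁)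
    (by simpa using hu) (by simpa using hv)] at h
  simp only [scratch, gridCell, RExp.eval, NExp.eval, nvar_eval, Store.setReal_real_self, hu, hv,
    hD₁] at h
  exact ⟨_, h⟩

theorem runs_treeLoop (hn : s.int 0 0 = n) (hD : ∀ u v : Fin n, s.real 0 u v = D u v)
    (ha : s.int 3 0 = a) (hr : s.real 3 0 0 = radius D a) {R : Mat n}
    (hR : ∀ u v : Fin n, s.real 4 u v = R u v) :
    ∃ s', Runs O (gridLoop treeProg) s s' (gridCost n 140) ∧ SameInt s s' ∧ SameReal 5 s s' ∧
      ∀ u v : Fin n, s'.real 5 u v = pivotTree D a R u v := by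
  refine Runs.fill (by decide) (pivotTree D a R) hn fun s₁ u v hi hre hu hv => ?_
  have hD₁ : ∀ u v : Fin n, s₁.real 0 u v = D u v := by simpa [hre 0] using hD
  have hR₁ : ∀ u v : Fin n, s₁.real 4 u v = R u v := by simpa [hre 4] using hR
  have ha₁ : s₁.int 3 0 = a := by simpa [hi 3] using ha
  have hr₁ : s₁.real 3 0 0 = radius D a := by simpa [hre 3] using hr
  have h₁ := runs_clampProg (O := O) hD₁ ha₁ hu hv (.sub (gridCell 4) slackExp)
  have h₂ := runs_offDiagProg (O := O) (u := u) (v := v)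
    (s := s₁.setReal 6 0 0 (clamp D a u v (RExp.eval s₁ (.sub (gridCell 4) slackExp)))) hu hv 5 scratch
  have h := (h₁.seq h₂).mono (p := treeProg) (C := 140) (by
        simp only [RExp.size, NExp.size, gridCell, slackExp, scratch, radiusCell, pivotDist,
          nvar_size]
        omega)
  rw [RExp.eval, slackExp_eval hD₁ ha₁ hr₁ hu hv] at h
  simp only [scratch, gridCell, RExp.eval, NExp.eval, nvar_eval, Store.setReal_real_self, hu, hv,
    hR₁] at h
  exact ⟨_, h⟩

theorem runs_copyLoop (hn : s.int 0 0 = n) {M : Mat n} (hM : ∀ u v : Fin n, s.real 5 u v = M u v) :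
    ∃ s', Runs O (gridLoop (.setR 1 (nvar 1) (nvar 2) (gridCell 5))) s s' (gridCost n 10) ∧
      SameInt s s' ∧ SameReal 1 s s' ∧ ∀ u v : Fin n, s'.real 1 u v = M u v := by
  -- Copying needs no scratch cell, so the scratch value offered is the one already there.
  refine Runs.fill (by decide) M hn fun s₁ u v hi hre hu hv => ⟨s₁.real 6 0 0, ?_⟩
  rw [Store.setReal_same]
  have h := Runs.setR (O := O) s₁ 1 (nvar 1) (nvar 2) (gridCell 5)
  simpa only [nvar_eval, hu, hv, gridCell, RExp.eval, hre 5 (by decide) (by decide), hM, RExp.size,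
    nvar_size] using h

-- No array is filled here, so the grid rule is used directly: the counter equals the sum over the
-- finished rows plus the treated part of the current row.
open Classical in
theorem runs_countLoop (hn : s.int 0 0 = n) (hD : ∀ u v : Fin n, s.real 0 u v = D u v)
    {M : Mat n} (hM : ∀ u v : Fin n, s.real 5 u v = M u v) (h4 : s.int 4 0 = 0) :
    ∃ s', Runs O (gridLoop countProg) s s' (gridCost n 40) ∧
      (∀ b, b ≠ 1 → b ≠ 2 → b ≠ 4 → s'.int b = s.int b) ∧ s'.real = s.real ∧
      s'.int 4 0 = disagreements M D := by
  let g : ℕ → ℕ → ℕ := fun i j => if i < j ∧ s.real 5 i j ≠ s.real 0 i j then 1 else 0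
  let Inv : ℕ → ℕ → Store → Prop := fun i j s' =>
    (∀ b, b ≠ 1 → b ≠ 2 → b ≠ 4 → s'.int b = s.int b) ∧ s'.real = s.real ∧
      s'.int 4 0 = ∑ k ∈ Finset.range i, ∑ l ∈ Finset.range n, g k l + ∑ l ∈ Finset.range j, g i l
  have step : ∀ (u v : Fin n) s₁, Inv u v s₁ → s₁.int 1 0 = u → s₁.int 2 0 = v →
      ∃ s', Runs O countProg s₁ s' 40 ∧ s'.int 1 0 = u ∧ s'.int 2 0 = v ∧
        Inv u (v + 1) s' := by
    rintro u v s₁ ⟨h₁, h₂, h₃⟩ hu hv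
    by_cases h : u.1 < v.1 ∧ s.real 5 u v ≠ s.real 0 u v
    · refine ⟨s₁.setInt 4 0 (s₁.int 4 0 + 1), (Runs.ite_true ?_ (Runs.setN s₁ 4 (.const 0)
        (.add (nvar 4) (.const 1)))).mono ?_, by simpa using hu, by simpa using hv,
        fun b hb hb' hb'' => by simpa [hb''] using h₁ b hb hb' hb'', h₂, ?_⟩
      · simp only [BExp.holds, nvar_eval, hu, hv, gridCell, RExp.eval, h₂, not_le]
        exact ⟨h.1, fun h' => h.2 (le_antisymm h'.1 h'.2)⟩
      · simp [BExp.size, NExp.size, RExp.size, gridCell]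
      · rw [Store.setInt_int_self, h₃, Finset.sum_range_succ _ v.1, ← add_assoc]
        simp only [g, if_pos h]
    · refine ⟨s₁, (Runs.ite_false ?_ (Runs.nop s₁)).mono ?_, hu, hv, h₁, h₂, ?_⟩
      · simp only [BExp.holds, nvar_eval, hu, hv, gridCell, RExp.eval, h₂, not_le]
        exact fun h' => h ⟨h'.1, fun h'' => h'.2 ⟨h''.le, h''.ge⟩⟩
      · simp [BExp.size, RExp.size, gridCell]
      · rw [h₃, Finset.sum_range_succ _ v.1, ← add_assoc]
        simp only [g, if_neg h, add_zero]
  obtain ⟨s', hr, h₁, h₂, h₃⟩ := Runs.gridLoop Inv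
    (fun i j s' h => by rw [h.1 0 (by decide) (by decide) (by decide), hn])
    (fun i j s' x h => ⟨fun b h₁ h₂ h₄ => by simp [h₁, h.1 b h₁ h₂ h₄], h.2.1, by simpa using h.2.2⟩)
    (fun i j s' x h => ⟨fun b h₁ h₂ h₄ => by simp [h₂, h.1 b h₁ h₂ h₄], h.2.1, by simpa using h.2.2⟩)
    (fun i s' h => ⟨h.1, h.2.1, by rw [h.2.2, Finset.sum_range_succ]; simp⟩)
    step (s := s) ⟨fun _ _ _ _ => rfl, rfl, by simpa using h4⟩
  refine ⟨s', hr, h₁, h₂, ?_⟩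
  rw [h₃, disagreements_eq_sum, Finset.sum_range, Finset.sum_range_zero, add_zero]
  refine Finset.sum_congr rfl fun u _ => ?_
  rw [Finset.sum_range]
  refine Finset.sum_congr rfl fun v _ => ?_
  simp only [g, hM, hD, Fin.lt_def]

/-- The first pivot (number `0`) must be kept unconditionally: no cost has been recorded yet, and
the initial content `0` of the record would look unbeatable. -/
theorem runs_keepProg (hn : s.int 0 0 = n) {M : Mat n}
    (hM : ∀ u v : Fin n, s.real 5 u v = M u v) :
    ∃ s', Runs O keepProg s s' (gridCost n 10 + 20) ∧ s'.int 0 0 = n ∧ s'.int 3 0 = s.int 3 0 ∧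
      s'.real 0 = s.real 0 ∧
      ((1 ≤ s.int 3 0 ∧ s.int 5 0 ≤ s.int 4 0) ∧ s'.int 5 0 = s.int 5 0 ∧ s'.real 1 = s.real 1 ∨
        ¬ (1 ≤ s.int 3 0 ∧ s.int 5 0 ≤ s.int 4 0) ∧ s'.int 5 0 = s.int 4 0 ∧
          ∀ u v : Fin n, s'.real 1 u v = M u v) := by
  by_cases h : 1 ≤ s.int 3 0 ∧ s.int 5 0 ≤ s.int 4 0
  · refine ⟨s, (Runs.ite_true (by exact h) (Runs.nop s)).mono ?_, hn, rfl, rfl, .inl ⟨h, rfl, rfl⟩⟩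
    simp only [BExp.size, NExp.size, nvar_size]
    omega
  · obtain ⟨s', hr, hi, hre, h'⟩ := runs_copyLoop (O := O) hn hM
    refine ⟨s'.setInt 5 0 (s'.int 4 0), (Runs.ite_false (by exact h)
      (hr.seq (Runs.setN s' 5 (.const 0) (nvar 4)))).mono ?_, ?_, ?_, ?_, .inr ⟨h, ?_, ?_⟩⟩
    · simp only [BExp.size, NExp.size, nvar_size]
      omega
    · simpa [hi 0] using hn
    · simp [hi 3]
    · simp [hre 0]
    · simp [hi 4]
    · simpa using h'

/-- The cost of one pivot, without the oracle. -/
def pivotCost (n : ℕ) : ℕ :=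
  n * 25 + 2 * n ^ 2 + 2 * gridCost n 140 + gridCost n 40 + gridCost n 10 + 50

theorem runs_pivotProg (hn : s.int 0 0 = n) (hD : ∀ u v : Fin n, s.real 0 u v = D u v)
    (ha : s.int 3 0 = a) {R : Mat n} {c : ℕ} (hO : O n (pivotQuery D a) = some (R, c)) :
    ∃ s', Runs O pivotProg s s' (c + pivotCost n) ∧ s'.int 0 0 = n ∧ s'.int 3 0 = a ∧
      (∀ u v : Fin n, s'.real 0 u v = D u v) ∧
      ((1 ≤ a.1 ∧ s.int 5 0 ≤ disagreements (pivotTree D a R) D) ∧ s'.int 5 0 = s.int 5 0 ∧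
          s'.real 1 = s.real 1 ∨
        ¬ (1 ≤ a.1 ∧ s.int 5 0 ≤ disagreements (pivotTree D a R) D) ∧
          s'.int 5 0 = disagreements (pivotTree D a R) D ∧ s'.read 1 n = pivotTree D a R) := by
  obtain ⟨s₁, r₁, i₁, e₁, h₁⟩ := runs_radiusProg (O := O) hn hD ha
  have hn₁ : s₁.int 0 0 = n := by simpa [i₁ 0] using hn
  have ha₁ : s₁.int 3 0 = a := by simpa [i₁ 3] using ha
  have hD₁ : ∀ u v : Fin n, s₁.real 0 u v = D u v := by simpa [e₁ 0] using hD
  obtain ⟨s₂, r₂, i₂, e₂, h₂⟩ := runs_queryLoop (O := O) hn₁ hD₁ ha₁ h₁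
  have hn₂ : s₂.int 0 0 = n := by simpa [i₂ 0] using hn₁
  have hq : s₂.read 2 n = pivotQuery D a := by
    funext u v
    exact h₂ u v
  rw [← hq] at hO
  have r₃ := Runs.oracle (dst := 4) (k := nvar 0) hn₂ hO
  obtain ⟨s₄, r₄, i₄, e₄, h₄⟩ := runs_treeLoop (O := O) (s := s₂.write 4 R) (a := a) (R := R)
    (by simpa using hn₂) (by simpa [e₂ 0] using hD₁) (by simpa [i₂ 3] using ha₁)
    (by simpa [e₂ 3] using h₁) (by simp)
  obtain ⟨s₅, r₅, i₅, e₅, h₅⟩ := runs_countLoop (O := O) (s := s₄.setInt 4 0 0) (D := D)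
    (by simpa [i₄ 0] using hn₂) (by simpa [e₄ 0, e₂ 0] using hD₁)
    (by simpa using h₄) (by simp)
  obtain ⟨s₆, r₆, hn₆, ha₆, hD₆, h₆⟩ := runs_keepProg (O := O) (n := n) (s := s₅)
    (M := pivotTree D a R)
    (by simpa [i₅ 0, i₄ 0] using hn₂) (by simpa [e₅] using h₄)
  have e0 : s₅.real 0 = s.real 0 := by simp [e₅, e₄ 0, e₂ 0, e₁ 0]
  have e1 : s₅.real 1 = s.real 1 := by simp [e₅, e₄ 1, e₂ 1, e₁ 1]
  have i3 : s₅.int 3 0 = a := by simpa [i₅ 3, i₄ 3, i₂ 3] using ha₁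
  have i5 : s₅.int 5 = s.int 5 := by simp [i₅ 5, i₄ 5, i₂ 5, i₁ 5]
  refine ⟨s₆, (r₁.seq (r₂.seq (r₃.seq (r₄.seq
    ((Runs.setN s₄ 4 (.const 0) (.const 0)).seq (r₅.seq r₆)))))).mono ?_, hn₆, ha₆.trans i3, ?_, ?_⟩
  · simp only [NExp.size, nvar_size, pivotCost]
    omega
  · rw [hD₆, e0]
    exact hD
  · rw [i3, h₅, i5, e1] at h₆
    refine h₆.imp id fun h => ⟨h.1, h.2.1, ?_⟩
    funext u v
    exact h.2.2 u v

/-- The program finds the best of the tree metrics of all pivots. -/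
theorem runs_fitTreeProg {D : Mat n} {R : Fin n → Mat n} {c : Fin n → ℕ} {t : ℕ}
    (hO : ∀ a, O n (pivotQuery D a) = some (R a, c a)) (hc : ∀ a, c a ≤ t) :
    ∃ s', Runs O fitTreeProg (Store.init D) s' (n * (t + pivotCost n + 13) + 10) ∧
      (0 < n → ∃ a, s'.read 1 n = pivotTree D a (R a) ∧ ∀ b,
        disagreements (pivotTree D a (R a)) D ≤ disagreements (pivotTree D b (R b)) D) := by
  -- The guard `0 < i` is there because no candidate exists before the first pivot.
  let Inv : ℕ → Store → Prop := fun i s => s.int 0 0 = n ∧ s.int 3 0 = i ∧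
    (∀ u v : Fin n, s.real 0 u v = D u v) ∧
    (0 < i → ∃ a, s.read 1 n = pivotTree D a (R a) ∧
      s.int 5 0 = disagreements (pivotTree D a (R a)) D ∧
      ∀ b : Fin n, b.1 < i → s.int 5 0 ≤ disagreements (pivotTree D b (R b)) D)
  have step : ∀ i < n, ∀ s, Inv i s → ∃ s', Runs O pivotProg s s' (t + pivotCost n) ∧
      s'.int 3 0 = i ∧ Inv (i + 1) (s'.setInt 3 0 (i + 1)) := by
    rintro i hi s ⟨h₁, h₂, h₃, h₄⟩
    obtain ⟨s', hr, h₁', h₂', h₃', h⟩ := runs_pivotProg (a := ⟨i, hi⟩) h₁ h₃ h₂ (hO ⟨i, hi⟩)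
    refine ⟨s', hr.mono (Nat.add_le_add_right (hc _) _), h₂', by simpa using h₁', by simp,
      by simpa using h₃', fun _ => ?_⟩
    simp only [Store.setInt_int_of_ne _ (show 5 ≠ 3 by decide)]
    rcases h with ⟨h, h5, h1⟩ | ⟨h, h5, h1⟩
    · obtain ⟨a, ha, ha', hb⟩ := h₄ h.1
      refine ⟨a, ?_, h5.trans ha', fun b hbi => ?_⟩
      · rw [← ha]
        funext u v
        simp [Store.read, h1]
      · rw [h5]
        rcases Nat.lt_succ_iff_lt_or_eq.mp hbi with hbi | rfl
        · exact hb b hbi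
        · exact h.2
    · refine ⟨⟨i, hi⟩, h1, h5, fun b hbi => ?_⟩
      rw [h5]
      rcases Nat.lt_succ_iff_lt_or_eq.mp hbi with hbi | rfl
      · have hi' : 1 ≤ i := by omega
        obtain ⟨a, ha, ha', hb⟩ := h₄ hi'
        have := hb b hbi
        have : ¬ s.int 5 0 ≤ _ := fun h' => h ⟨hi', h'⟩
        omega
      · exact le_rfl
  obtain ⟨s', hr, -, -, -, h⟩ := Runs.forLoop Inv (fun i s h => ⟨h.1, h.2.1⟩) step
    (s := Store.init D) ⟨by simp [Store.init], by simp, by simp [Store.init], by simp⟩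
  refine ⟨s', hr, fun hn => ?_⟩
  obtain ⟨a, ha, ha', hb⟩ := h hn
  exact ⟨a, ha, fun b => ha' ▸ hb b b.2⟩

end Correctness

/-! ### The reduction -/

/-- The time of the reduction, without the oracle. -/
noncomputable def overhead : Polynomial ℕ :=
  let grid : ℕ → Polynomial ℕ := fun B =>
    .X * (.X * (.C B + 13) + 23) + 10
  .X * (.X * 25 + 2 * .X ^ 2 + 2 * grid 140 + grid 40 + grid 10 + 50 + 13) + 10

theorem overhead_eval (n : ℕ) : overhead.eval n = n * (pivotCost n + 13) + 10 := by
  simp [overhead, pivotCost, gridCost]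

/-- Without elements there is no pivot and hence no candidate; this makes the output feasible in
that case. -/
theorem isTreeMetric_of_size_zero (M : Mat 0) : IsTreeMetric M :=
  isTreeMetric_of_strong_triangle (U := M) (fun u => u.elim0) (fun u => u.elim0)
    (fun u => u.elim0) (fun u => u.elim0) (fun u => u.elim0) (fun u => u.elim0)

/-- The pivot `b` that competes with `S` depends on `S`, the output does not: it is at least as good
as the results of all pivots. -/
theorem fitTreeProg_isApproxAlgorithm {O : Oracle} {ρ : ℝ} (hρ : 1 ≤ ρ) {t : ℕ → ℕ}
    (hO : IsApproxOracle IsUltrametric O ρ t) :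
    IsApproxAlgorithm IsTreeMetric O fitTreeProg (6 * ρ)
      (fun n => n * t n + overhead.eval n) := by
  intro n D hD
  choose R c hRc hR hc using fun a => hO n (pivotQuery D a) (pivotQuery_isDistanceMatrix hD a)
  obtain ⟨s, ⟨d, hd, hs⟩, h⟩ := runs_fitTreeProg hRc hc
  refine ⟨s.read 1 n, d, ⟨s, hs, rfl⟩, ?_, hd.trans_eq ?_⟩
  · rcases Nat.eq_zero_or_pos n with rfl | hn
    · exact ⟨isTreeMetric_of_size_zero _, fun S _ => by simp [disagreements]⟩
    · obtain ⟨a, ha, hb⟩ := h hn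
      rw [ha]
      refine ⟨pivotTree_isTreeMetric a (hR a).1, fun S hS => ?_⟩
      obtain ⟨b, hb'⟩ := exists_pivotTree_le hn hD hρ hR hS
      exact le_trans (mod_cast hb b) hb'
  · simp only [overhead_eval]
    ring

/-! ### Replacing the oracle by a program -/

open Classical in
/-- The black box given by an approximation algorithm. -/
noncomputable def algorithmOracle {A : Prog} {ρ : ℝ} {t : ℕ → ℕ}
    (hA : IsApproxAlgorithm IsUltrametric noOracle A ρ t) : Oracle := fun n D =>
  -- The algorithm promises nothing on other inputs. No answer is needed there, since all queries of
  -- the reduction are distance matrices.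
  if h : IsDistanceMatrix D then some ((hA n D h).choose, (hA n D h).choose_spec.choose) else none

theorem algorithmOracle_isApproxOracle {A : Prog} {ρ : ℝ} {t : ℕ → ℕ}
    (hA : IsApproxAlgorithm IsUltrametric noOracle A ρ t) :
    IsApproxOracle IsUltrametric (algorithmOracle hA) ρ t := fun n D hD =>
  ⟨_, _, dif_pos hD, (hA n D hD).choose_spec.choose_spec.2⟩

theorem algorithmOracle_computes {A : Prog} {ρ : ℝ} {t : ℕ → ℕ}
    (hA : IsApproxAlgorithm IsUltrametric noOracle A ρ t) {n : ℕ} {D R : Mat n} {c : ℕ}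
    (h : algorithmOracle hA n D = some (R, c)) : A.Computes noOracle D R c := by
  unfold algorithmOracle at h
  split_ifs at h with hD
  obtain ⟨rfl, rfl⟩ := Prod.mk.inj (Option.some.inj h)
  exact (hA n D hD).choose_spec.choose_spec.1

/-- A program in the place of an oracle with the same answers and the same times changes neither
the result nor the running time. -/
theorem Exec.subst {O O' : Oracle} {A : Prog}
    (hA : ∀ (n : ℕ) (D R : Mat n) (c : ℕ), O n D = some (R, c) → A.Computes O' D R c)
    {p : Prog} {s s' : Store} {c : ℕ} (h : Exec O p s s' c) : Exec O' (p.subst A) s s' c := by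
  induction h with
  | nop s => exact .nop s
  | setN s a i e => exact .setN s a i e
  | setR s a i j e => exact .setR s a i j e
  | seq _ _ ih₁ ih₂ => exact .seq ih₁ ih₂
  | ite_true hb _ ih => exact .ite_true hb ih
  | ite_false hb _ ih => exact .ite_false hb ih
  | loop_true hb _ _ ih₁ ih₂ => exact .loop_true hb ih₁ ih₂
  | loop_false hb => exact .loop_false hb
  | oracle h =>
    obtain ⟨s', hs', rfl⟩ := hA _ _ _ _ h
    exact .call hs'
  | call _ ih => exact .call ih

/-- The outputs and times of `A` define a black box, to which the oracle version applies. Its run is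
replayed with calls of `A`; calls and oracle queries are charged alike, so the time bound is
unchanged. -/
theorem fitTreeProg_subst_isApproxAlgorithm {A : Prog} {ρ : ℝ} (hρ : 1 ≤ ρ) {t : ℕ → ℕ}
    (hA : IsApproxAlgorithm IsUltrametric noOracle A ρ t) :
    IsApproxAlgorithm IsTreeMetric noOracle (fitTreeProg.subst A) (6 * ρ)
      (fun n => n * t n + overhead.eval n) := by
  intro n D hD
  obtain ⟨R, c, ⟨s, hs, hR⟩, h⟩ :=
    fitTreeProg_isApproxAlgorithm hρ (algorithmOracle_isApproxOracle hA) n D hD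
  exact ⟨R, c, ⟨s, hs.subst fun _ _ _ _ => algorithmOracle_computes hA, hR⟩, h⟩

end L0Fit

/-- One oracle program `P`, independent of the factor and of the black box, turns every factor `ρ`
approximation for `L₀` Fitting Ultrametrics into a factor `6 ρ` approximation for `L₀` Fitting Tree
Metrics with polynomial overhead: for black boxes of any kind, and for programs put in the place of
the oracle. -/
theorem theorem1 :
    ∃ (P : L0Fit.Prog) (q : Polynomial ℕ), ∀ (ρ : ℝ), 1 ≤ ρ → ∀ t : ℕ → ℕ,
      (∀ O : L0Fit.Oracle, L0Fit.IsApproxOracle L0Fit.IsUltrametric O ρ t →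
        L0Fit.IsApproxAlgorithm L0Fit.IsTreeMetric O P (6 * ρ)
          (fun n => n * t n + q.eval n)) ∧
      (∀ A : L0Fit.Prog, L0Fit.IsApproxAlgorithm L0Fit.IsUltrametric L0Fit.noOracle A ρ t →
        L0Fit.IsApproxAlgorithm L0Fit.IsTreeMetric L0Fit.noOracle (P.subst A) (6 * ρ)
          (fun n => n * t n + q.eval n)) :=
  ⟨L0Fit.fitTreeProg, L0Fit.overhead, fun _ hρ _ =>
    ⟨fun _ hO => L0Fit.fitTreeProg_isApproxAlgorithm hρ hO,
      fun _ hA => L0Fit.fitTreeProg_subst_isApproxAlgorithm hρ hA⟩⟩
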